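/- Let $a>b\ge 2$ be integers, $A=\{0,\dots,a-1\}$, $B=\{0,\dots,b-1\}$, and let $\Omega\subset(A\times B)^{\mathbb N}$ be a non-empty subshift (closed, $\sigma(\Omega)\subset\Omega$ for the one-sided shift $\sigma$). Let $\pi:(A\times B)^{\mathbb N}\to B^{\mathbb N}$ be the projection and $\Omega'=\pi(\Omega)$. Let $$X_\Omega=\Bigl\{\Bigl(\sum_{m\ge1}\tfrac{x_m}{a^m},\sum_{m\ge1}\tfrac{y_m}{b^m}\Bigr)\in[0,1]^{\mathbb N}\times[0,1]^{\mathbb N}:\ (x_m,y_m)\in\Omega\text{ for all }m\ge1\Bigr\}$$ (sums taken coordinatewise), with the metric $d((x,y),(x',y'))=\sum_{n\ge1}2^{-n}\max\{|x_n-x_n'|,|y_n-y_n'|\}$ and the shift $\sigma$ acting simultaneously on both sequences. For a compact metric space $(X,d)$ and a continuous map $T:X\to X$, put $d_M(x,y)=\max_{0\le m<M}d(T^mx,T^my)$ and $B_{d_M}(x,r)=\{y:d_M(x,y)\le r\}$; for $K\subset X$ let $N_{d_M}(K,\varepsilon)$ be the least $n\ge1$ such that $K$ is covered by $n$ open subsets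 of $X$ of $d_M$-diameter at most $\varepsilon$. For $0<\rho<r$ let $S(X,r,\rho)=\lim_{M\to\infty}\frac1M\sup_{x\in X}\log N_{d_M}(B_{d_M}(x,r),\rho)$, and define $$\mathrm{mdim}_A(X,T,d)=\inf\{s>0:\exists C>0\ \forall\,0<\rho<r:\ e^{S(X,r,\rho)}\le C(r/\rho)^s\},$$ $$\mathrm{mdim}_A^\theta(X,T,d)=\inf\{s>0:\exists C>0\ \forall\,0<r<1:\ e^{S(X,r,r^{1/\theta})}\le C(r/r^{1/\theta})^s\}\quad(0<\theta<1).$$ Let $\mathrm{mdim}_M(X,T,d)=\lim_{\varepsilon\to0}\lim_{M\to\infty}\frac{\log N_{d_M}(X,\varepsilon)}{M\log(1/\varepsilon)}$ (metric mean dimension, when the limit over $\varepsilon$ exists). Let $h_{top}(\Omega,\sigma)$ and $h_{top}(\Omega',\sigma)$ be the topological entropies, and let $$h_{top}(\Omega|\Omega',\sigma)=\lim_{\varepsilon\to0}\lim_{M\to\infty}\frac1M\sup_{y\in\Omega'}\log N_{\mathbf d_M}(\Omega\cap\pi^{-1}(y),\varepsilon)$$ be the topological conditional entropy, where $\mathbf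 d$ is a metric inducing the product topology of $\Omega$. Then all these entropies are finite, $\mathrm{mdim}_M(X_\Omega,\sigma,d)$ exists and is finite, $$\mathrm{mdim}_A(X_\Omega,\sigma,d)=\frac{h_{top}(\Omega|\Omega',\sigma)}{\log a}+\frac{h_{top}(\Omega',\sigma)}{\log b},$$ and for every $\theta\in(0,1)$, $\mathrm{mdim}_A^\theta(X_\Omega,\sigma,d)=\min\{F(\theta),\ \mathrm{mdim}_A(X_\Omega,\sigma,d)\}$, where $$F(\theta)=\frac{\mathrm{mdim}_M(X_\Omega,\sigma,d)-\theta\Bigl(\bigl(\frac1{\log a}-\frac1{\log b}\bigr)h_{top}(\Omega|\Omega',\sigma)+\frac{h_{top}(\Omega,\sigma)}{\log b}\Bigr)}{1-\theta}.$$ Moreover, $\mathrm{mdim}_A^\theta(X_\Omega,\sigma,d)=F(\theta)$ if $\theta\le\log b/\log a$, and $\mathrm{mdim}_A^\theta(X_\Omega,\sigma,d)=\mathrm{mdim}_A(X_\Omega,\sigma,d)$ if $\theta\ge\log b/\log a$. -/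

import Mathlib

open Filter Topology Set
open scoped ENNReal

noncomputable section

namespace MeanAssouad

/-! ### Dynamical dimensions

A system is a compact metrizable space `X` with a compatible metric `d : X → X → ℝ` and a continuous
map `T : X → X`.  Quantities are valued in `EReal`, so that no default value is attached to an
infimum over an empty set or to an unbounded supremum.  The sequences in `M` below are
sub-additive, so the limit of `(1 / M) * (M-th term)` exists and is written as a `limsup`; likewise
the limits as `ε → 0` in the two entropies are monotone limits. -/

section General

variable {X Y : Type*} [TopologicalSpace X]

/-- The Bowen metric `d_M(x, y) = max_{0 ≤ m < M} d(T^m x, T^m y)`. -/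
def bowenDist (d : X → X → ℝ) (T : X → X) (M : ℕ) (x y : X) : ℝ :=
  ⨆ m : Fin M, d (T^[m] x) (T^[m] y)

/-- The closed Bowen ball `B_{d_M}(x, r)`. -/
def bowenBall (d : X → X → ℝ) (T : X → X) (M : ℕ) (x : X) (r : ℝ) : Set X :=
  {y | bowenDist d T M x y ≤ r}

/-- The covering number `N_d(K, ε)`: the least `n ≥ 1` such that `K` is covered by `n` open subsets
of `X` of `d`-diameter at most `ε` (`⊤` if there is no such `n`). -/
def coveringNumber (d : X → X → ℝ) (K : Set X) (ε : ℝ) : ℕ∞ :=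
  ⨅ (n : ℕ) (_ : 1 ≤ n ∧ ∃ U : Fin n → Set X, (∀ i, IsOpen (U i)) ∧ K ⊆ ⋃ i, U i ∧
    ∀ i, ∀ x ∈ U i, ∀ y ∈ U i, d x y ≤ ε), (n : ℕ∞)

/-- `log N_{d_M}(K, ε)`. -/
def logCovering (d : X → X → ℝ) (T : X → X) (M : ℕ) (K : Set X) (ε : ℝ) : EReal :=
  ENNReal.log (coveringNumber (bowenDist d T M) K ε : ℝ≥0∞)

/-- Topological entropy `lim_{ε → 0} lim_{M → ∞} log N_{d_M}(X, ε) / M`. -/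
def topEntropy (d : X → X → ℝ) (T : X → X) : EReal :=
  limsup (fun ε : ℝ => limsup (fun M : ℕ => logCovering d T M univ ε / (M : EReal)) atTop)
    (𝓝[>] 0)

/-- Topological conditional entropy of a factor map `π : X → Y`,
`lim_{ε → 0} lim_{M → ∞} sup_{y ∈ Y} log N_{d_M}(π⁻¹(y), ε) / M`. -/
def topCondEntropy (d : X → X → ℝ) (T : X → X) (π : X → Y) : EReal :=
  limsup (fun ε : ℝ => limsup (fun M : ℕ =>
    (⨆ y : Y, logCovering d T M (π ⁻¹' {y}) ε) / (M : EReal)) atTop) (𝓝[>] 0)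

/-- `lim_{M → ∞} log N_{d_M}(X, ε) / (M log (1 / ε))`. -/
def scaledGrowth (d : X → X → ℝ) (T : X → X) (ε : ℝ) : EReal :=
  limsup (fun M : ℕ => logCovering d T M univ ε / ((M * Real.log (1 / ε) : ℝ) : EReal)) atTop

/-- Upper metric mean dimension. -/
def upperMetricMeanDim (d : X → X → ℝ) (T : X → X) : EReal :=
  limsup (scaledGrowth d T) (𝓝[>] 0)

/-- Lower metric mean dimension. -/
def lowerMetricMeanDim (d : X → X → ℝ) (T : X → X) : EReal :=
  liminf (scaledGrowth d T) (𝓝[>] 0)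

/-- `S(X, r, ρ) = lim_{M → ∞} (1 / M) sup_{x ∈ X} log N_{d_M}(B_{d_M}(x, r), ρ)`. -/
def localGrowth (d : X → X → ℝ) (T : X → X) (r ρ : ℝ) : EReal :=
  limsup (fun M : ℕ => (⨆ x : X, logCovering d T M (bowenBall d T M x r) ρ) / (M : EReal)) atTop

/-- Mean Assouad dimension. -/
def meanAssouadDim (d : X → X → ℝ) (T : X → X) : EReal :=
  ⨅ (s : ℝ) (_ : 0 < s ∧ ∃ C : ℝ, 0 < C ∧ ∀ r ρ : ℝ, 0 < ρ → ρ < r →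
    EReal.exp (localGrowth d T r ρ) ≤ ENNReal.ofReal (C * (r / ρ) ^ s)), (s : EReal)

/-- Mean Assouad spectrum at `θ ∈ (0, 1)`. -/
def meanAssouadSpectrum (d : X → X → ℝ) (T : X → X) (θ : ℝ) : EReal :=
  ⨅ (s : ℝ) (_ : 0 < s ∧ ∃ C : ℝ, 0 < C ∧ ∀ r : ℝ, 0 < r → r < 1 →
    EReal.exp (localGrowth d T r (r ^ (1 / θ))) ≤
      ENNReal.ofReal (C * (r / r ^ (1 / θ)) ^ s)), (s : EReal)

end General

/-! ### Subshifts

Sequences are indexed by `ℕ = {0, 1, 2, …}`; the `n`-th entry here is the entry number `n + 1` in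
the usual indexing by positive integers. -/

/-- The left shift on one-sided sequences. -/
def shift {α : Type*} (x : ℕ → α) : ℕ → α := fun n => x (n + 1)

/-- The metric `2^{-min {n ≥ 1 : x_n ≠ y_n}}` on sequences. -/
def seqDist {α : Type*} (x y : ℕ → α) : ℝ :=
  open Classical in
  if x = y then 0 else (1 / 2) ^ (sInf {n : ℕ | x n ≠ y n} + 1)

/-- The projection `(A × B)^ℕ → B^ℕ`. -/
def proj {a b : ℕ} (w : ℕ → Fin a × Fin b) : ℕ → Fin b := fun n => (w n).2

theorem mapsTo_shift_image_proj {a b : ℕ} {Ω : Set (ℕ → Fin a × Fin b)}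
    (hΩ : MapsTo shift Ω Ω) : MapsTo shift (proj '' Ω) (proj '' Ω) := by
  rintro _ ⟨w, hw, rfl⟩
  exact ⟨shift w, hΩ hw, rfl⟩

/-- Topological entropy of the subshift `(Ω, σ)`. -/
def subshiftEntropy {α : Type*} [TopologicalSpace α] {Ω : Set (ℕ → α)}
    (hΩ : MapsTo shift Ω Ω) : EReal :=
  topEntropy (fun x y : Ω => seqDist x.1 y.1) (hΩ.restrict shift Ω Ω)

/-- Topological conditional entropy of the factor map `π : (Ω, σ) → (π(Ω), σ)`. -/
def subshiftCondEntropy {a b : ℕ} {Ω : Set (ℕ → Fin a × Fin b)}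
    (hΩ : MapsTo shift Ω Ω) : EReal :=
  topCondEntropy (fun x y : Ω => seqDist x.1 y.1) (hΩ.restrict shift Ω Ω)
    ((mapsTo_image proj Ω).restrict proj Ω (proj '' Ω))

/-! ### Bedford–McMullen carpet systems -/

/-- The product `[0,1]^ℕ × [0,1]^ℕ`. -/
abbrev CubePair : Type := (ℕ → unitInterval) × (ℕ → unitInterval)

/-- The metric `∑_{n ≥ 1} 2^{-n} max (|x_n - x'_n|, |y_n - y'_n|)`. -/
def cubeDist (p q : CubePair) : ℝ :=
  ∑' n : ℕ, (1 / 2 : ℝ) ^ (n + 1) *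
    max |(p.1 n : ℝ) - (q.1 n : ℝ)| |(p.2 n : ℝ) - (q.2 n : ℝ)|

/-- The simultaneous shift on `[0,1]^ℕ × [0,1]^ℕ`. -/
def cubeShift (p : CubePair) : CubePair := (shift p.1, shift p.2)

/-- The carpet `X_Ω`: all points `(∑_{m ≥ 1} x_m / a^m, ∑_{m ≥ 1} y_m / b^m)` with
`(x_m, y_m) ∈ Ω` for every `m`, the sums being taken coordinatewise.  Here `w m n` is the `n`-th
symbol of the `m`-th sequence. -/
def carpet {a b : ℕ} (Ω : Set (ℕ → Fin a × Fin b)) : Set CubePair :=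
  {p | ∃ w : ℕ → ℕ → Fin a × Fin b, (∀ m, w m ∈ Ω) ∧ ∀ n,
    (p.1 n : ℝ) = ∑' m : ℕ, (((w m n).1 : ℕ) : ℝ) / (a : ℝ) ^ (m + 1) ∧
    (p.2 n : ℝ) = ∑' m : ℕ, (((w m n).2 : ℕ) : ℝ) / (b : ℝ) ^ (m + 1)}

theorem mapsTo_cubeShift_carpet {a b : ℕ} {Ω : Set (ℕ → Fin a × Fin b)}
    (hΩ : MapsTo shift Ω Ω) : MapsTo cubeShift (carpet Ω) (carpet Ω) := by
  rintro p ⟨w, hw, hp⟩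
  exact ⟨fun m => shift (w m), fun m => hΩ (hw m), fun n => hp (n + 1)⟩

/-- The metric `d` restricted to `X_Ω`. -/
def carpetDist {a b : ℕ} (Ω : Set (ℕ → Fin a × Fin b)) (p q : carpet Ω) : ℝ :=
  cubeDist p.1 q.1

/-- The shift on `X_Ω`. -/
def carpetShift {a b : ℕ} {Ω : Set (ℕ → Fin a × Fin b)} (hΩ : MapsTo shift Ω Ω) :
    carpet Ω → carpet Ω :=
  (mapsTo_cubeShift_carpet hΩ).restrict cubeShift (carpet Ω) (carpet Ω)

end MeanAssouad

end

/-! A point of the carpet is coded by rows `w 0, w 1, …` in `Ω`, row `m` carrying the `m`-th digits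
of all coordinates. At scale `e ^ (-u)` a coordinate is seen through about `u / log a` horizontal
and `u / log b` vertical digits. To cover a Bowen ball of radius `e ^ (-u)` by sets of size `e ^
(-v)`, one therefore counts, row by row, the words of length about `M` still undetermined. Rows
below `u / log a` are known. Rows between `u / log a` and `u / log b` have known projection, so a
visible horizontal part costs a fibre word. Later rows cost a full word of `Ω` below `v / log a`,
and a word of `proj '' Ω` from there up to `v / log b`.

Dividing logarithms by `M` turns the three counts into the entropies `hc`, `h`, `h'`. The local
growth is then `growthRate a b h h' hc u v` up to an error independent of `u` and `v`
(`localGrowth_carpet_bounds`): neighbouring grid cells cost `log 36`, rounding of levels costs `5 *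
(hc + h + h')`.

The function `growthRate` is homogeneous of degree one and piecewise linear, with a break at `v /
log a = u / log b`. Its value at `(0, 1)` is the metric mean dimension, and `growthRate θ 1 / (1 -
θ)` is the spectrum, whence the threshold `log b / log a`. Since `h ≤ hc + h'`, it is at most `(hc /
log a + h' / log b) * (v - u)`, with equality when `v / log a ≤ u / log b`; this gives the Assouad
dimension.

Conditional entropy refers to fibres over points, while the count produces fibres over finite words.
Compactness shows that both grow at the same rate (`tendsto_log_pointFiberCount_div`). -/

namespace MeanAssouad

/-! ### Word counts and subadditivity -/

section Words

variable {α : Type*}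

/-- The prefix of length `M` of a sequence. -/
def restr (M : ℕ) (x : ℕ → α) : Fin M → α := fun i => x i

/-- The words of length `M` occurring as prefixes in `Ω`. -/
def words (Ω : Set (ℕ → α)) (M : ℕ) : Set (Fin M → α) := restr M '' Ω

/-- The number of words of length `M`. -/
noncomputable def wordCount (Ω : Set (ℕ → α)) (M : ℕ) : ℕ := (words Ω M).ncard

theorem shift_iterate_apply (x : ℕ → α) (j n : ℕ) : shift^[j] x n = x (n + j) := by
  induction j generalizing n with
  | zero => rfl
  | succ j ih =>
    rw [Function.iterate_succ_apply']
    simp only [shift]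
    rw [ih]
    congr 1
    ring

theorem shift_iterate_mem {Ω : Set (ℕ → α)} (hΩ : MapsTo shift Ω Ω) {x : ℕ → α} (hx : x ∈ Ω)
    (j : ℕ) : shift^[j] x ∈ Ω := hΩ.iterate j hx

theorem ncard_le_mul_of_split [Finite α] {M N : ℕ} {S : Set (Fin (M + N) → α)}
    {A : Set (Fin M → α)} {B : Set (Fin N → α)} (hA : ∀ u ∈ S, (fun i => u (Fin.castAdd N i)) ∈ A)
    (hB : ∀ u ∈ S, (fun i => u (Fin.natAdd M i)) ∈ B) : S.ncard ≤ A.ncard * B.ncard := by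
  rw [← Set.ncard_prod]
  refine Set.ncard_le_ncard_of_injOn
    (fun u => ((fun i => u (Fin.castAdd N i)), (fun i => u (Fin.natAdd M i))))
    (fun u hu => ⟨hA u hu, hB u hu⟩) ?_ (Set.toFinite _)
  intro u _ v _ huv
  simp only [Prod.mk.injEq] at huv
  funext i
  refine Fin.addCases (fun j => ?_) (fun j => ?_) i
  · exact congrFun huv.1 j
  · exact congrFun huv.2 j

theorem restr_natAdd (x : ℕ → α) (M N : ℕ) :
    (fun i => restr (M + N) x (Fin.natAdd M i)) = restr N (shift^[M] x) := by
  funext i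
  simp [restr, shift_iterate_apply, add_comm]

theorem wordCount_add_le [Finite α] {Ω : Set (ℕ → α)} (hΩ : MapsTo shift Ω Ω) (M N : ℕ) :
    wordCount Ω (M + N) ≤ wordCount Ω M * wordCount Ω N := by
  refine ncard_le_mul_of_split ?_ ?_
  · rintro _ ⟨x, hx, rfl⟩
    exact ⟨x, hx, rfl⟩
  · rintro _ ⟨x, hx, rfl⟩
    rw [restr_natAdd]
    exact ⟨_, shift_iterate_mem hΩ hx M, rfl⟩

theorem one_le_wordCount [Finite α] {Ω : Set (ℕ → α)} (hne : Ω.Nonempty) (M : ℕ) :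
    1 ≤ wordCount Ω M :=
  (Set.ncard_pos (Set.toFinite _)).2 (hne.image _)

/-- Fekete's lemma for `log c`. The limit is an infimum; the resulting last inequality is what the
comparison of the two fibre counts needs. -/
theorem exists_tendsto_log_div {c : ℕ → ℕ} (h1 : ∀ M, 1 ≤ c M)
    (hc : ∀ M N, c (M + N) ≤ c M * c N) :
    ∃ l : ℝ, 0 ≤ l ∧ Tendsto (fun M : ℕ => Real.log (c M) / M) atTop (𝓝 l) ∧
      ∀ M : ℕ, M ≠ 0 → l ≤ Real.log (c M) / M := by
  have hsub : Subadditive fun M => Real.log (c M) := by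
    intro M N
    have hM : (c M : ℝ) ≠ 0 := by have := h1 M; positivity
    have hN : (c N : ℝ) ≠ 0 := by have := h1 N; positivity
    have hMN : (0 : ℝ) < c (M + N) := by have := h1 (M + N); positivity
    simp only
    rw [← Real.log_mul hM hN]
    exact Real.log_le_log hMN (by exact_mod_cast hc M N)
  have hnn : ∀ M : ℕ, 0 ≤ Real.log (c M) / M := fun M =>
    div_nonneg (Real.log_nonneg (by exact_mod_cast h1 M)) (Nat.cast_nonneg M)
  have hbdd : BddBelow (range fun M : ℕ => Real.log (c M) / M) :=
    ⟨0, by rintro _ ⟨M, rfl⟩; exact hnn M⟩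
  exact ⟨hsub.lim, ge_of_tendsto' (hsub.tendsto_lim hbdd) hnn, hsub.tendsto_lim hbdd,
    fun M hM => hsub.lim_le_div hbdd hM⟩

end Words

/-! ### Fibres over words and fibres over points -/

section Fibers

variable {a b : ℕ}

/-- The words of `Ω` of length `M` that project to `v`. -/
def fiberWords (Ω : Set (ℕ → Fin a × Fin b)) {M : ℕ} (v : Fin M → Fin b) :
    Set (Fin M → Fin a × Fin b) :=
  {u | u ∈ words Ω M ∧ ∀ i, (u i).2 = v i}

/-- The maximal number of words of `Ω` of length `M` over a word in the letters `B`. -/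
noncomputable def fiberCount (Ω : Set (ℕ → Fin a × Fin b)) (M : ℕ) : ℕ :=
  Finset.univ.sup fun v : Fin M → Fin b => (fiberWords Ω v).ncard

/-- The maximal number of words of length `M` in a fiber of `Ω` over a point of `proj '' Ω`. -/
noncomputable def pointFiberCount (Ω : Set (ℕ → Fin a × Fin b)) (M : ℕ) : ℕ :=
  ⨆ y : proj '' Ω, wordCount (Ω ∩ proj ⁻¹' {y.1}) M

variable {Ω : Set (ℕ → Fin a × Fin b)}

theorem ncard_fiberWords_le {M : ℕ} (v : Fin M → Fin b) :
    (fiberWords Ω v).ncard ≤ fiberCount Ω M :=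
  Finset.le_sup (f := fun v : Fin M → Fin b => (fiberWords Ω v).ncard) (Finset.mem_univ v)

theorem restr_mem_fiberWords {x : ℕ → Fin a × Fin b} (hx : x ∈ Ω) (M : ℕ) :
    restr M x ∈ fiberWords Ω (restr M (proj x)) := ⟨⟨x, hx, rfl⟩, fun _ => rfl⟩

theorem one_le_fiberCount (hne : Ω.Nonempty) (M : ℕ) : 1 ≤ fiberCount Ω M := by
  obtain ⟨x, hx⟩ := hne
  exact (Nat.succ_le_of_lt ((Set.ncard_pos (Set.toFinite _)).2
    ⟨_, restr_mem_fiberWords hx M⟩)).trans (ncard_fiberWords_le _)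

/-- A maximal fibre is nonempty, so it lies over the prefix of a genuine point of `Ω`. That point
later serves as the centre of the worst ball. -/
theorem exists_ncard_fiberWords_eq (hne : Ω.Nonempty) (M : ℕ) :
    ∃ z ∈ Ω, (fiberWords Ω (restr M (proj z))).ncard = fiberCount Ω M := by
  obtain ⟨x, hx⟩ := hne
  obtain ⟨v, -, hv⟩ := Finset.exists_mem_eq_sup (Finset.univ : Finset (Fin M → Fin b))
    ⟨restr M (proj x), Finset.mem_univ _⟩ (fun v => (fiberWords Ω v).ncard)
  have hpos : 0 < (fiberWords Ω v).ncard := by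
    have := one_le_fiberCount ⟨x, hx⟩ (Ω := Ω) M
    rw [fiberCount, hv] at this
    exact this
  obtain ⟨u, ⟨z, hz, rfl⟩, hu⟩ := (Set.ncard_pos (Set.toFinite _)).1 hpos
  refine ⟨z, hz, ?_⟩
  have : restr M (proj z) = v := funext hu
  rw [this, fiberCount, hv]

theorem fiberCount_add_le (hΩ : MapsTo shift Ω Ω) (M N : ℕ) :
    fiberCount Ω (M + N) ≤ fiberCount Ω M * fiberCount Ω N := by
  refine Finset.sup_le fun v _ => ?_
  refine (ncard_le_mul_of_split (A := fiberWords Ω fun i => v (Fin.castAdd N i))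
    (B := fiberWords Ω fun i => v (Fin.natAdd M i)) ?_ ?_).trans
    (Nat.mul_le_mul (ncard_fiberWords_le _) (ncard_fiberWords_le _))
  · rintro _ ⟨⟨x, hx, rfl⟩, hv⟩
    exact ⟨⟨x, hx, rfl⟩, fun i => hv (Fin.castAdd N i)⟩
  · rintro _ ⟨⟨x, hx, rfl⟩, hv⟩
    refine ⟨?_, fun i => hv (Fin.natAdd M i)⟩
    rw [restr_natAdd]
    exact ⟨_, shift_iterate_mem hΩ hx M, rfl⟩

theorem ncard_le_mul_ncard_image {β γ : Type*} [Finite β] [Finite γ] (S : Set β) (f : β → γ)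
    (n : ℕ) (h : ∀ c, {x | x ∈ S ∧ f x = c}.ncard ≤ n) : S.ncard ≤ n * (f '' S).ncard := by
  classical
  have := Fintype.ofFinite β
  have := Fintype.ofFinite γ
  have key := Finset.card_le_mul_card_image (f := f) S.toFinset n (fun c _ => by
    refine le_trans (le_of_eq ?_) (h c)
    rw [← Set.ncard_coe_finset]
    congr 1
    ext x
    simp)
  rwa [← Set.toFinset_image, ← Set.ncard_eq_toFinset_card', ← Set.ncard_eq_toFinset_card'] at key

theorem image_snd_words (M : ℕ) :
    (fun (u : Fin M → Fin a × Fin b) i => (u i).2) '' words Ω M = words (proj '' Ω) M := by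
  simp only [words, Set.image_image]
  rfl

theorem wordCount_le_fiberCount_mul (M : ℕ) :
    wordCount Ω M ≤ fiberCount Ω M * wordCount (proj '' Ω) M := by
  have h := ncard_le_mul_ncard_image (words Ω M) (fun u i => (u i).2) (fiberCount Ω M) (fun c => by
    refine le_trans (le_of_eq ?_) (ncard_fiberWords_le (Ω := Ω) c)
    congr 1
    ext u
    simp [fiberWords, funext_iff])
  rwa [image_snd_words] at h

theorem words_fiber_subset_fiberWords (y : ℕ → Fin b) (M : ℕ) :
    words (Ω ∩ proj ⁻¹' {y}) M ⊆ fiberWords Ω (restr M y) := by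
  rintro _ ⟨x, ⟨hx, rfl⟩, rfl⟩
  exact restr_mem_fiberWords hx M

theorem bddAbove_wordCount_fiber (M : ℕ) :
    BddAbove (range fun y : proj '' Ω => wordCount (Ω ∩ proj ⁻¹' {y.1}) M) := by
  refine ⟨fiberCount Ω M, ?_⟩
  rintro _ ⟨y, rfl⟩
  exact (Set.ncard_le_ncard (words_fiber_subset_fiberWords y.1 M)).trans (ncard_fiberWords_le _)

theorem pointFiberCount_le_fiberCount (hne : Ω.Nonempty) (M : ℕ) :
    pointFiberCount Ω M ≤ fiberCount Ω M := by
  have : Nonempty (proj '' Ω) := (hne.image _).to_subtype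
  exact ciSup_le fun y => (Set.ncard_le_ncard (words_fiber_subset_fiberWords y.1 M)).trans
    (ncard_fiberWords_le _)

theorem wordCount_fiber_le {y : ℕ → Fin b} (hy : y ∈ proj '' Ω) (M : ℕ) :
    wordCount (Ω ∩ proj ⁻¹' {y}) M ≤ pointFiberCount Ω M :=
  le_ciSup (bddAbove_wordCount_fiber M) (⟨y, hy⟩ : proj '' Ω)

theorem fiber_nonempty {y : ℕ → Fin b} (hy : y ∈ proj '' Ω) : (Ω ∩ proj ⁻¹' {y}).Nonempty := by
  obtain ⟨x, hx, rfl⟩ := hy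
  exact ⟨x, hx, rfl⟩

theorem one_le_pointFiberCount (hne : Ω.Nonempty) (M : ℕ) : 1 ≤ pointFiberCount Ω M := by
  obtain ⟨y, hy⟩ := hne.image proj
  exact (one_le_wordCount (fiber_nonempty hy) M).trans (wordCount_fiber_le hy M)

/-- The words of length `N` of points of `Ω` whose projection agrees with `y` up to `K`. -/
def nearFiberWords (Ω : Set (ℕ → Fin a × Fin b)) (N K : ℕ) (y : ℕ → Fin b) :
    Set (Fin N → Fin a × Fin b) :=
  restr N '' {x | x ∈ Ω ∧ ∀ i < K, (x i).2 = y i}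

theorem nearFiberWords_anti (N : ℕ) {K K' : ℕ} (h : K ≤ K') (y : ℕ → Fin b) :
    nearFiberWords Ω N K' y ⊆ nearFiberWords Ω N K y :=
  Set.image_mono fun _ hx => ⟨hx.1, fun i hi => hx.2 i (hi.trans_le h)⟩

theorem nearFiberWords_congr (N : ℕ) {K : ℕ} {y y' : ℕ → Fin b} (h : ∀ i < K, y i = y' i) :
    nearFiberWords Ω N K y = nearFiberWords Ω N K y' := by
  have : {x | x ∈ Ω ∧ ∀ i < K, (x i).2 = y i} = {x | x ∈ Ω ∧ ∀ i < K, (x i).2 = y' i} := by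
    ext x
    refine and_congr_right fun _ => forall₂_congr fun i hi => ?_
    rw [h i hi]
  rw [nearFiberWords, this, nearFiberWords]

/-- Compactness: a word extendable to points of `Ω` whose projections agree with `y` arbitrarily far
extends to a point exactly over `y`. There are finitely many words, so one `K` suffices for all. -/
theorem exists_nearFiberWords_subset_words_fiber (hcl : IsClosed Ω) (N : ℕ) (y : ℕ → Fin b) :
    ∃ K, nearFiberWords Ω N K y ⊆ words (Ω ∩ proj ⁻¹' {y}) N := by
  have key : ∀ u : Fin N → Fin a × Fin b, ∃ K, u ∈ nearFiberWords Ω N K y →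
      u ∈ words (Ω ∩ proj ⁻¹' {y}) N := by
    intro u
    by_contra! hcon
    -- If `u` were bad for every `K`, these nested nonempty compact sets would share a point, which
    -- lies over `y` and starts with `u`.
    let Z : ℕ → Set (ℕ → Fin a × Fin b) := fun K =>
      {x | x ∈ Ω ∧ (∀ i < K, (x i).2 = y i) ∧ ∀ i : Fin N, x i = u i}
    have hZcl : ∀ K, IsClosed (Z K) := by
      intro K
      have h1 : IsClosed {x : ℕ → Fin a × Fin b | ∀ i < K, (x i).2 = y i} := by
        simp only [Set.ofPred_forall]
        exact isClosed_iInter fun i => isClosed_iInter fun _ =>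
          isClosed_eq (continuous_snd.comp (continuous_apply i)) continuous_const
      have h2 : IsClosed {x : ℕ → Fin a × Fin b | ∀ i : Fin N, x i = u i} := by
        simp only [Set.ofPred_forall]
        exact isClosed_iInter fun i => isClosed_eq (continuous_apply _) continuous_const
      exact hcl.inter (h1.inter h2)
    have hne : ∀ K, (Z K).Nonempty := by
      intro K
      obtain ⟨x, ⟨hx, hxy⟩, hxu⟩ := (hcon K).1
      exact ⟨x, hx, hxy, fun i => congrFun hxu i⟩
    obtain ⟨x, hx⟩ := IsCompact.nonempty_iInter_of_sequence_nonempty_isCompact_isClosed Z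
      (fun K x hx => ⟨hx.1, fun i hi => hx.2.1 i (by omega), hx.2.2⟩) hne (hZcl 0).isCompact hZcl
    rw [Set.mem_iInter] at hx
    refine (hcon 0).2 ⟨x, ⟨(hx 0).1, ?_⟩, funext (hx 0).2.2⟩
    exact funext fun i => (hx (i + 1)).2.1 i (Nat.lt_succ_self i)
  choose K hK using key
  refine ⟨Finset.univ.sup K, fun u hu => hK u ?_⟩
  exact nearFiberWords_anti N (Finset.le_sup (Finset.mem_univ u)) y hu

theorem continuous_proj : Continuous (proj : (ℕ → Fin a × Fin b) → ℕ → Fin b) :=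
  continuous_pi fun n => continuous_snd.comp (continuous_apply n)

theorem isOpen_cylinder {α : Type*} [TopologicalSpace α] [DiscreteTopology α] (K : ℕ)
    (y : ℕ → α) : IsOpen {y' : ℕ → α | ∀ i < K, y' i = y i} := by
  have : {y' : ℕ → α | ∀ i < K, y' i = y i} = ⋂ i ∈ Finset.range K, (fun y' => y' i) ⁻¹' {y i} := by
    ext y'
    simp
  rw [this]
  exact isOpen_biInter_finset fun i _ => (isOpen_discrete _).preimage (continuous_apply i)

/-- The `K` found for one `y` works on a whole cylinder around it, and finitely many cylinders cover
the compact set `proj '' Ω`. -/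
theorem exists_ncard_nearFiberWords_le (hcl : IsClosed Ω) (N : ℕ) :
    ∃ K, ∀ y ∈ proj '' Ω, (nearFiberWords Ω N K y).ncard ≤ pointFiberCount Ω N := by
  have hcomp : IsCompact (proj '' Ω) := hcl.isCompact.image continuous_proj
  choose K hK using exists_nearFiberWords_subset_words_fiber hcl N
  obtain ⟨t, ht, hcov⟩ := hcomp.elim_nhds_subcover (fun y => {y' | ∀ i < K y, y' i = y i})
    (fun y _ => (isOpen_cylinder (K y) y).mem_nhds fun _ _ => rfl)
  refine ⟨t.sup K, fun y hy => ?_⟩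
  obtain ⟨z, hz, hyz⟩ := Set.mem_iUnion₂.1 (hcov hy)
  refine (Set.ncard_le_ncard ?_).trans (wordCount_fiber_le (ht z hz) N)
  refine (nearFiberWords_anti N (Finset.le_sup hz) y).trans ?_
  rw [nearFiberWords_congr N hyz]
  exact hK z

/-- Peel off the first `N` letters repeatedly. As long as the projected word has at least `K`
letters, the removed block has at most `pointFiberCount Ω N` values; the last `K` letters are
counted crudely. -/
theorem exists_fiberCount_le_pointFiberCount_pow (hcl : IsClosed Ω) (hΩ : MapsTo shift Ω Ω)
    (N : ℕ) :
    ∃ K, ∀ j, fiberCount Ω (j * N + K) ≤ pointFiberCount Ω N ^ j * fiberCount Ω K := by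
  obtain ⟨K, hK⟩ := exists_ncard_nearFiberWords_le hcl N
  refine ⟨K, fun j => ?_⟩
  induction j with
  | zero => simp
  | succ j ih =>
    have hstep : fiberCount Ω (N + (j * N + K)) ≤
        pointFiberCount Ω N * fiberCount Ω (j * N + K) := by
      refine Finset.sup_le fun v _ => ?_
      rcases (fiberWords Ω v).eq_empty_or_nonempty with hemp | ⟨_, ⟨z, hz, rfl⟩, hzv⟩
      · rw [hemp]
        simp
      refine (ncard_le_mul_of_split (A := nearFiberWords Ω N K (proj z))
        (B := fiberWords Ω fun i => v (Fin.natAdd N i)) ?_ ?_).trans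
        (Nat.mul_le_mul (hK _ ⟨z, hz, rfl⟩) (ncard_fiberWords_le _))
      · rintro _ ⟨⟨x, hx, rfl⟩, hv⟩
        refine ⟨x, ⟨hx, fun i hi => ?_⟩, rfl⟩
        have hi' : i < N + (j * N + K) := by omega
        exact (hv ⟨i, hi'⟩).trans (hzv ⟨i, hi'⟩).symm
      · rintro _ ⟨⟨x, hx, rfl⟩, hv⟩
        refine ⟨?_, fun i => hv (Fin.natAdd N i)⟩
        rw [restr_natAdd]
        exact ⟨_, shift_iterate_mem hΩ hx N, rfl⟩
    have heq : (j + 1) * N + K = N + (j * N + K) := by ring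
    rw [heq, pow_succ', mul_assoc]
    exact hstep.trans (Nat.mul_le_mul_left _ ih)

theorem tendsto_log_pointFiberCount_div (hne : Ω.Nonempty) (hcl : IsClosed Ω)
    (hΩ : MapsTo shift Ω Ω) {l : ℝ}
    (hl : Tendsto (fun M : ℕ => Real.log (fiberCount Ω M) / M) atTop (𝓝 l))
    (hle : ∀ M : ℕ, M ≠ 0 → l ≤ Real.log (fiberCount Ω M) / M) :
    Tendsto (fun M : ℕ => Real.log (pointFiberCount Ω M) / M) atTop (𝓝 l) := by
  have hE : ∀ N, (0 : ℝ) < pointFiberCount Ω N := fun N => by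
    exact_mod_cast one_le_pointFiberCount hne N
  have hD : ∀ N, (0 : ℝ) < fiberCount Ω N := fun N => by exact_mod_cast one_le_fiberCount hne N
  refine tendsto_of_tendsto_of_tendsto_of_le_of_le' tendsto_const_nhds hl ?_ ?_
  · filter_upwards [eventually_ne_atTop 0] with N hN
    obtain ⟨K, hK⟩ := exists_fiberCount_le_pointFiberCount_pow hcl hΩ N
    have hN' : (0 : ℝ) < N := by positivity
    rw [le_div_iff₀ hN']
    -- Compare the infimum bound at length `j * N + K` with the peeling bound and divide by `j`; the
    -- boundary term vanishes as `j → ∞`.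
    have hj : ∀ j : ℕ, 1 ≤ j → l * N ≤ Real.log (pointFiberCount Ω N)
        + (Real.log (fiberCount Ω K) - l * K) / j := by
      intro j hj
      have hj' : (0 : ℝ) < j := by positivity
      have h1 := hle (j * N + K) (by positivity)
      rw [le_div_iff₀ (by positivity)] at h1
      have h2 : Real.log (fiberCount Ω (j * N + K)) ≤
          j * Real.log (pointFiberCount Ω N) + Real.log (fiberCount Ω K) := by
        rw [← Real.log_pow, ← Real.log_mul (by have := hE N; positivity) (hD K).ne']
        exact Real.log_le_log (hD _) (by exact_mod_cast hK j)
      push_cast at h1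
      rw [← sub_le_iff_le_add', le_div_iff₀ hj']
      nlinarith
    have hlim : Tendsto (fun j : ℕ => Real.log (pointFiberCount Ω N)
        + (Real.log (fiberCount Ω K) - l * K) / j) atTop
        (𝓝 (Real.log (pointFiberCount Ω N) + 0)) :=
      tendsto_const_nhds.add (tendsto_const_div_atTop_nhds_zero_nat _)
    rw [add_zero] at hlim
    exact ge_of_tendsto hlim (by filter_upwards [eventually_ge_atTop 1] with j h using hj j h)
  · filter_upwards with N
    have := Real.log_le_log (hE N) (Nat.cast_le.2 (pointFiberCount_le_fiberCount hne N))
    gcongr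

theorem limit_le_add {h h' hc : ℝ} (hne : Ω.Nonempty)
    (hh : Tendsto (fun M : ℕ => Real.log (wordCount Ω M) / M) atTop (𝓝 h))
    (hh' : Tendsto (fun M : ℕ => Real.log (wordCount (proj '' Ω) M) / M) atTop (𝓝 h'))
    (hhc : Tendsto (fun M : ℕ => Real.log (fiberCount Ω M) / M) atTop (𝓝 hc)) :
    h ≤ hc + h' := by
  refine le_of_tendsto_of_tendsto' hh (hhc.add hh') fun M => ?_
  have h1 : (0 : ℝ) < wordCount Ω M := by exact_mod_cast one_le_wordCount hne M
  have h2 : (0 : ℝ) < wordCount (proj '' Ω) M := by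
    exact_mod_cast one_le_wordCount (hne.image _) M
  have h3 : (0 : ℝ) < fiberCount Ω M := by exact_mod_cast one_le_fiberCount hne M
  rw [← add_div, ← Real.log_mul h3.ne' h2.ne']
  gcongr
  exact_mod_cast wordCount_le_fiberCount_mul M

end Fibers

/-! ### Growth rates along shifted lengths -/

section Limits

theorem tendsto_shift_div {f : ℕ → ℝ} {l : ℝ} (hf : Tendsto (fun M : ℕ => f M / M) atTop (𝓝 l))
    (K : ℕ) : Tendsto (fun M : ℕ => f (M + K) / M) atTop (𝓝 l) := by
  have h1 : Tendsto (fun M : ℕ => f (M + K) / ((M + K : ℕ) : ℝ)) atTop (𝓝 l) :=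
    hf.comp (tendsto_add_atTop_nat K)
  have h2 : Tendsto (fun M : ℕ => 1 + (K : ℝ) / M) atTop (𝓝 (1 + 0)) :=
    tendsto_const_nhds.add (tendsto_const_div_atTop_nhds_zero_nat _)
  have h3 := h1.mul h2
  rw [add_zero, mul_one] at h3
  refine h3.congr' ?_
  filter_upwards [eventually_gt_atTop 0] with M hM
  have : (0 : ℝ) < M := by exact_mod_cast hM
  push_cast
  field_simp

theorem limsup_div_le {f : ℕ → EReal} {u c : ℕ → ℝ} {l : ℝ} (hc : ∀ M, 0 ≤ c M)
    (hf : ∀ᶠ M in atTop, f M ≤ (u M : EReal)) (hu : Tendsto (fun M => u M / c M) atTop (𝓝 l)) :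
    limsup (fun M => f M / ((c M : ℝ) : EReal)) atTop ≤ (l : EReal) := by
  rw [← ((continuous_coe_real_ereal.tendsto l).comp hu).limsup_eq]
  refine limsup_le_limsup ?_
  filter_upwards [hf] with M hM
  rw [Function.comp_apply, EReal.coe_div]
  exact EReal.div_le_div_right_of_nonneg (by exact_mod_cast hc M) hM

theorem le_limsup_div {f : ℕ → EReal} {u c : ℕ → ℝ} {l : ℝ} (hc : ∀ M, 0 ≤ c M)
    (hf : ∀ᶠ M in atTop, (u M : EReal) ≤ f M) (hu : Tendsto (fun M => u M / c M) atTop (𝓝 l)) :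
    (l : EReal) ≤ limsup (fun M => f M / ((c M : ℝ) : EReal)) atTop := by
  rw [← ((continuous_coe_real_ereal.tendsto l).comp hu).limsup_eq]
  refine limsup_le_limsup ?_
  filter_upwards [hf] with M hM
  rw [Function.comp_apply, EReal.coe_div]
  exact EReal.div_le_div_right_of_nonneg (by exact_mod_cast hc M) hM

end Limits

/-! ### Bounding covering numbers by codes and by pigeonhole -/

section Covering

variable {X : Type*} {d : X → X → ℝ} {T : X → X} {M : ℕ} {K : Set X} {ε : ℝ}

theorem le_bowenDist (x y : X) {m : ℕ} (hm : m < M) :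
    d (T^[m] x) (T^[m] y) ≤ bowenDist d T M x y :=
  le_ciSup (f := fun m : Fin M => d (T^[m] x) (T^[m] y)) (Set.finite_range _).bddAbove ⟨m, hm⟩

theorem bowenDist_le {x y : X} {c : ℝ} (hc : 0 ≤ c)
    (h : ∀ m < M, d (T^[m] x) (T^[m] y) ≤ c) : bowenDist d T M x y ≤ c :=
  Real.iSup_le (fun m => h m m.2) hc

variable [TopologicalSpace X]

theorem log_natCast {n : ℕ} (hn : 1 ≤ n) :
    ENNReal.log ((n : ℕ∞) : ℝ≥0∞) = (Real.log n : EReal) := by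
  have h0 : (0 : ℝ) < n := by positivity
  rw [← ENNReal.log_ofReal_of_pos h0, ENNReal.ofReal_natCast]
  rfl

theorem logCovering_le_log_natCast {n : ℕ} (hn : 1 ≤ n) (U : Fin n → Set X)
    (hU : ∀ i, IsOpen (U i)) (hK : K ⊆ ⋃ i, U i)
    (hd : ∀ i, ∀ x ∈ U i, ∀ y ∈ U i, bowenDist d T M x y ≤ ε) :
    logCovering d T M K ε ≤ (Real.log n : EReal) := by
  rw [← log_natCast hn]
  exact ENNReal.log_monotone (ENat.toENNReal_mono (iInf₂_le n ⟨hn, U, hU, hK, hd⟩))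

/-- One open set `U p` per value of the code `f` on `K`, where `p` is a chosen representative of
that value. -/
theorem logCovering_le_of_code {γ : Type*} [Finite γ] (f : X → γ) (U : X → Set X)
    (hU : ∀ p, IsOpen (U p)) (hd : ∀ p, ∀ x ∈ U p, ∀ y ∈ U p, bowenDist d T M x y ≤ ε)
    (hf : ∀ p ∈ K, ∀ q ∈ K, f p = f q → q ∈ U p) {c : ℝ} (hc : 1 ≤ c)
    (hcard : ((f '' K).ncard : ℝ) ≤ c) : logCovering d T M K ε ≤ (Real.log c : EReal) := by
  rcases K.eq_empty_or_nonempty with rfl | hK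
  · refine (logCovering_le_log_natCast le_rfl (fun _ => ∅) (fun _ => isOpen_empty)
      (Set.empty_subset _) (by simp)).trans ?_
    rw [EReal.coe_le_coe_iff, Nat.cast_one, Real.log_one]
    exact Real.log_nonneg hc
  · have hn : 1 ≤ (f '' K).ncard := (Set.ncard_pos (Set.toFinite _)).2 (hK.image f)
    let e : Fin (f '' K).ncard ≃ (f '' K) := (Finite.equivFinOfCardEq rfl).symm
    choose g hg using fun c : f '' K => c.2
    refine (logCovering_le_log_natCast hn (fun i => U (g (e i))) (fun i => hU _) ?_
      (fun i => hd _)).trans ?_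
    · intro q hq
      refine Set.mem_iUnion.2 ⟨e.symm ⟨f q, mem_image_of_mem f hq⟩, ?_⟩
      rw [e.apply_symm_apply]
      exact hf _ (hg _).1 q hq (hg _).2
    · rw [EReal.coe_le_coe_iff]
      exact Real.log_le_log (by exact_mod_cast hn) hcard

theorem le_logCovering {x : ℝ}
    (h : ∀ n : ℕ, 1 ≤ n → ∀ U : Fin n → Set X, K ⊆ ⋃ i, U i →
      (∀ i, ∀ x ∈ U i, ∀ y ∈ U i, bowenDist d T M x y ≤ ε) → x ≤ Real.log n) :
    (x : EReal) ≤ logCovering d T M K ε := by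
  rw [logCovering, ← EReal.log_exp (x : EReal)]
  refine ENNReal.log_monotone ?_
  rw [coveringNumber]
  rcases Set.eq_empty_or_nonempty {n : ℕ | 1 ≤ n ∧ ∃ U : Fin n → Set X, (∀ i, IsOpen (U i)) ∧
    K ⊆ ⋃ i, U i ∧ ∀ i, ∀ x ∈ U i, ∀ y ∈ U i, bowenDist d T M x y ≤ ε} with hS | hS
  · have : (⨅ (n : ℕ) (_ : 1 ≤ n ∧ ∃ U : Fin n → Set X, (∀ i, IsOpen (U i)) ∧ K ⊆ ⋃ i, U i ∧
        ∀ i, ∀ x ∈ U i, ∀ y ∈ U i, bowenDist d T M x y ≤ ε), (n : ℕ∞)) = ⊤ :=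
      iInf₂_eq_top.2 fun n hn => absurd (show n ∈ (∅ : Set ℕ) from hS ▸ hn) (by simp)
    rw [this]
    simp
  · obtain ⟨n, hn, hmin⟩ := (wellFounded_lt (α := ℕ)).has_min _ hS
    have : (n : ℕ∞) ≤ (⨅ (n : ℕ) (_ : 1 ≤ n ∧ ∃ U : Fin n → Set X, (∀ i, IsOpen (U i)) ∧
        K ⊆ ⋃ i, U i ∧ ∀ i, ∀ x ∈ U i, ∀ y ∈ U i, bowenDist d T M x y ≤ ε), (n : ℕ∞)) :=
      le_iInf₂ fun k hk => by exact_mod_cast not_lt.1 (hmin k hk)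
    refine le_trans ?_ (ENat.toENNReal_mono this)
    obtain ⟨h1, U, -, hcov, hd⟩ := hn
    have hx := h n h1 U hcov hd
    have h0 : (0 : ℝ) < n := by exact_mod_cast h1
    rw [Real.le_log_iff_exp_le h0] at hx
    rw [EReal.exp_coe]
    refine (ENNReal.ofReal_le_ofReal hx).trans ?_
    rw [ENNReal.ofReal_natCast]
    rfl

/-- Pigeonhole: each member of a cover contains at most `Q` of the points `p c`, so `F.card ≤ n *
Q`. Allowing `Q > 1` spares the choice of a genuinely separated family. -/
theorem log_sub_log_le_logCovering {ι : Type*} (F : Finset ι) (p : ι → X)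
    (hF : F.Nonempty) (hp : ∀ c ∈ F, p c ∈ K) {Q : ℝ} (hQ : 0 < Q)
    (h : ∀ G ⊆ F, (∀ c ∈ G, ∀ c' ∈ G, bowenDist d T M (p c) (p c') ≤ ε) → (G.card : ℝ) ≤ Q) :
    ((Real.log F.card - Real.log Q : ℝ) : EReal) ≤ logCovering d T M K ε := by
  classical
  refine le_logCovering fun n hn U hcov hd => ?_
  have hcard : (F.card : ℝ) ≤ n * Q := by
    have hsub : F ⊆ Finset.univ.biUnion fun i : Fin n => F.filter fun c => p c ∈ U i := by
      intro c hc
      obtain ⟨i, hi⟩ := Set.mem_iUnion.1 (hcov (hp c hc))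
      exact Finset.mem_biUnion.2 ⟨i, Finset.mem_univ _, Finset.mem_filter.2 ⟨hc, hi⟩⟩
    have h1 : F.card ≤ ∑ i : Fin n, (F.filter fun c => p c ∈ U i).card :=
      (Finset.card_le_card hsub).trans Finset.card_biUnion_le
    have h2 : ((∑ i : Fin n, (F.filter fun c => p c ∈ U i).card : ℕ) : ℝ) ≤ ∑ i : Fin n, Q := by
      push_cast
      refine Finset.sum_le_sum fun i _ => h _ (Finset.filter_subset _ _) fun c hc c' hc' => ?_
      exact hd i _ (Finset.mem_filter.1 hc).2 _ (Finset.mem_filter.1 hc').2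
    refine (Nat.cast_le.2 h1).trans (h2.trans (le_of_eq ?_))
    simp
  have hn' : (0 : ℝ) < n := by exact_mod_cast hn
  have hF' : (0 : ℝ) < F.card := by exact_mod_cast hF.card_pos
  rw [sub_le_iff_le_add, ← Real.log_mul hn'.ne' hQ.ne']
  exact Real.log_le_log hF' hcard

theorem logCovering_mono {K' : Set X} (h : K ⊆ K') :
    logCovering d T M K ε ≤ logCovering d T M K' ε := by
  refine ENNReal.log_monotone (ENat.toENNReal_mono ?_)
  exact le_iInf₂ fun n ⟨hn, U, hU, hcov, hd⟩ => iInf₂_le n ⟨hn, U, hU, h.trans hcov, hd⟩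

theorem logCovering_anti {ε' : ℝ} (h : ε' ≤ ε) :
    logCovering d T M K ε ≤ logCovering d T M K ε' := by
  refine ENNReal.log_monotone (ENat.toENNReal_mono ?_)
  exact le_iInf₂ fun n ⟨hn, U, hU, hcov, hd⟩ =>
    iInf₂_le n ⟨hn, U, hU, hcov, fun i x hx y hy => (hd i x hx y hy).trans h⟩

end Covering

/-! ### Entropies of subshifts as word growth rates -/

section Subshift

variable {α : Type*}

theorem seqDist_le_of_agree {x y : ℕ → α} {K : ℕ} (h : ∀ i < K, x i = y i) :
    seqDist x y ≤ (1 / 2) ^ K := by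
  classical
  rw [seqDist]
  split_ifs with hxy
  · positivity
  · obtain ⟨i, hi⟩ := Function.ne_iff.1 hxy
    refine pow_le_pow_of_le_one (by norm_num) (by norm_num) ?_
    refine Nat.le_succ_of_le (le_csInf ⟨i, hi⟩ fun j hj => ?_)
    by_contra! hlt
    exact hj (h j hlt)

theorem apply_zero_eq_of_seqDist_lt {x y : ℕ → α} (h : seqDist x y < 1 / 2) : x 0 = y 0 := by
  classical
  by_contra hne
  have hxy : x ≠ y := fun h => hne (congrFun h 0)
  have h0 : sInf {n : ℕ | x n ≠ y n} = 0 := Nat.sInf_eq_zero.2 (Or.inl hne)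
  rw [seqDist, if_neg hxy, h0] at h
  norm_num at h

variable {Ω : Set (ℕ → α)}

theorem coe_restrict_shift_iterate (hΩ : MapsTo shift Ω Ω) (x : Ω) (m n : ℕ) :
    ((hΩ.restrict shift Ω Ω)^[m] x).1 n = x.1 (n + m) := by
  rw [hΩ.iterate_restrict, MapsTo.val_restrict_apply, shift_iterate_apply]

theorem apply_eq_of_bowenDist_lt (hΩ : MapsTo shift Ω Ω) {M : ℕ} {x y : Ω}
    (h : bowenDist (fun x y : Ω => seqDist x.1 y.1) (hΩ.restrict shift Ω Ω) M x y < 1 / 2)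
    {m : ℕ} (hm : m < M) : x.1 m = y.1 m := by
  have h1 := apply_zero_eq_of_seqDist_lt ((le_bowenDist x y hm).trans_lt h)
  rwa [coe_restrict_shift_iterate, coe_restrict_shift_iterate, zero_add] at h1

theorem bowenDist_le_of_agree (hΩ : MapsTo shift Ω Ω) {M K : ℕ} {x y : Ω}
    (h : ∀ i < M + K, x.1 i = y.1 i) :
    bowenDist (fun x y : Ω => seqDist x.1 y.1) (hΩ.restrict shift Ω Ω) M x y ≤ (1 / 2) ^ K := by
  refine bowenDist_le (by positivity) fun m hm => seqDist_le_of_agree fun i hi => ?_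
  rw [coe_restrict_shift_iterate, coe_restrict_shift_iterate]
  exact h _ (by omega)

variable [TopologicalSpace α]

/-- Cylinders of length `M + K` have Bowen diameter at most `2 ^ (-K)`; the extra `K` letters do not
affect the rate in `M`. -/
theorem logCovering_subshift_le [DiscreteTopology α] [Finite α] (hΩ : MapsTo shift Ω Ω)
    {S : Set Ω} (hS : S.Nonempty) (M : ℕ) {K : ℕ} {ε : ℝ} (hK : (1 / 2) ^ K ≤ ε) :
    logCovering (fun x y : Ω => seqDist x.1 y.1) (hΩ.restrict shift Ω Ω) M S ε ≤
      (Real.log (wordCount (Subtype.val '' S) (M + K)) : EReal) := by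
  refine logCovering_le_of_code (fun p : Ω => restr (M + K) p.1)
    (fun p : Ω => {q : Ω | ∀ i < M + K, q.1 i = p.1 i})
    (fun p => (isOpen_cylinder (M + K) p.1).preimage continuous_subtype_val) ?_ ?_ ?_ ?_
  · intro p x hx y hy
    exact (bowenDist_le_of_agree hΩ fun i hi => (hx i hi).trans (hy i hi).symm).trans hK
  · intro p _ q _ hpq i hi
    exact (congrFun hpq ⟨i, hi⟩).symm
  · exact_mod_cast one_le_wordCount (hS.image _) _
  · rw [wordCount, words, Set.image_image]

/-- Below scale `1 / 2`, points with distinct prefixes of length `M` cannot share a covering set, so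
the pigeonhole bound applies with `Q = 1`. -/
theorem le_logCovering_subshift [Finite α] (hΩ : MapsTo shift Ω Ω)
    {S : Set Ω} (hS : S.Nonempty) (M : ℕ) {ε : ℝ} (hε : ε < 1 / 2) :
    (Real.log (wordCount (Subtype.val '' S) M) : EReal) ≤
      logCovering (fun x y : Ω => seqDist x.1 y.1) (hΩ.restrict shift Ω Ω) M S ε := by
  classical
  have hfin : (words (Subtype.val '' S) M).Finite := Set.toFinite _
  have hrep : ∀ u : Fin M → α, ∃ p : Ω, u ∈ words (Subtype.val '' S) M → p ∈ S ∧
      restr M p.1 = u := by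
    intro u
    by_cases hu : u ∈ words (Subtype.val '' S) M
    · obtain ⟨_, ⟨p, hp, rfl⟩, rfl⟩ := hu
      exact ⟨p, fun _ => ⟨hp, rfl⟩⟩
    · exact ⟨hS.some, fun h => absurd h hu⟩
  choose p hp using hrep
  have h := log_sub_log_le_logCovering (d := fun x y : Ω => seqDist x.1 y.1)
    (T := hΩ.restrict shift Ω Ω) (M := M) (K := S) (ε := ε) hfin.toFinset p
    (by rw [Set.Finite.toFinset_nonempty]; exact (hS.image _).image _)
    (fun c hc => (hp c (hfin.mem_toFinset.1 hc)).1) one_pos ?_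
  · rwa [Real.log_one, sub_zero, ← Set.ncard_eq_toFinset_card _ hfin] at h
  · intro G hG hd
    have : G.card ≤ 1 := by
      refine Finset.card_le_one.2 fun u hu v hv => ?_
      rw [← (hp u (hfin.mem_toFinset.1 (hG hu))).2, ← (hp v (hfin.mem_toFinset.1 (hG hv))).2]
      exact funext fun i => apply_eq_of_bowenDist_lt hΩ ((hd u hu v hv).trans_lt hε) i.2
    exact_mod_cast this

theorem limsup_nhdsGT_eq_of_forall {f : ℝ → EReal} {l : EReal} {δ : ℝ} (hδ : 0 < δ)
    (h : ∀ ε, 0 < ε → ε < δ → f ε = l) : limsup f (𝓝[>] 0) = l := by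
  have : f =ᶠ[𝓝[>] 0] fun _ => l := by
    filter_upwards [Ioo_mem_nhdsGT hδ] with ε hε using h ε hε.1 hε.2
  rw [limsup_congr this, limsup_const]

theorem limsup_div_eq_of_le_of_le {f : ℕ → EReal} {u : ℕ → ℝ} {l : ℝ} {K : ℕ}
    (h1 : ∀ M, (u M : EReal) ≤ f M) (h2 : ∀ M, f M ≤ (u (M + K) : EReal))
    (hu : Tendsto (fun M : ℕ => u M / M) atTop (𝓝 l)) :
    limsup (fun M => f M / (M : EReal)) atTop = (l : EReal) :=
  le_antisymm
    (limsup_div_le (c := fun M : ℕ => (M : ℝ)) (u := fun M => u (M + K)) (fun M => M.cast_nonneg)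
      (Eventually.of_forall h2) (tendsto_shift_div hu K))
    (le_limsup_div (c := fun M : ℕ => (M : ℝ)) (fun M => M.cast_nonneg)
      (Eventually.of_forall h1) hu)

theorem subshiftEntropy_eq [DiscreteTopology α] [Finite α] (hΩ : MapsTo shift Ω Ω)
    (hne : Ω.Nonempty) {h : ℝ}
    (hh : Tendsto (fun M : ℕ => Real.log (wordCount Ω M) / M) atTop (𝓝 h)) :
    subshiftEntropy hΩ = (h : EReal) := by
  have hS : (univ : Set Ω).Nonempty := by
    have := hne.to_subtype
    exact univ_nonempty
  have himg : Subtype.val '' (univ : Set Ω) = Ω := by simp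
  refine limsup_nhdsGT_eq_of_forall (δ := 1 / 2) (by norm_num) fun ε hε hε' => ?_
  obtain ⟨K, hK⟩ := exists_pow_lt_of_lt_one hε (by norm_num : (1 / 2 : ℝ) < 1)
  refine limsup_div_eq_of_le_of_le (K := K) (u := fun M => Real.log (wordCount Ω M))
    (fun M => ?_) (fun M => ?_) hh
  · have := le_logCovering_subshift hΩ hS M hε'
    rwa [himg] at this
  · have := logCovering_subshift_le hΩ hS M hK.le
    rwa [himg] at this

theorem subshiftCondEntropy_eq {a b : ℕ} {Ω : Set (ℕ → Fin a × Fin b)} (hΩ : MapsTo shift Ω Ω)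
    (hne : Ω.Nonempty) {l : ℝ}
    (hl : Tendsto (fun M : ℕ => Real.log (pointFiberCount Ω M) / M) atTop (𝓝 l)) :
    subshiftCondEntropy hΩ = (l : EReal) := by
  have himg : ∀ y : proj '' Ω, Subtype.val ''
      ((mapsTo_image proj Ω).restrict proj Ω (proj '' Ω) ⁻¹' {y}) = Ω ∩ proj ⁻¹' {y.1} := by
    intro y
    ext x
    constructor
    · rintro ⟨x, hx, rfl⟩
      exact ⟨x.2, congrArg Subtype.val hx⟩
    · rintro ⟨hx, hxy⟩
      exact ⟨⟨x, hx⟩, Subtype.ext hxy, rfl⟩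
  have hS : ∀ y : proj '' Ω,
      ((mapsTo_image proj Ω).restrict proj Ω (proj '' Ω) ⁻¹' {y}).Nonempty := by
    intro y
    have := fiber_nonempty y.2
    rw [← himg y] at this
    exact this.of_image
  have : Nonempty (proj '' Ω) := (hne.image _).to_subtype
  refine limsup_nhdsGT_eq_of_forall (δ := 1 / 2) (by norm_num) fun ε hε hε' => ?_
  obtain ⟨K, hK⟩ := exists_pow_lt_of_lt_one hε (by norm_num : (1 / 2 : ℝ) < 1)
  refine limsup_div_eq_of_le_of_le (K := K) (u := fun M => Real.log (pointFiberCount Ω M))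
    (fun M => ?_) (fun M => iSup_le fun y => ?_) hl
  · obtain ⟨y, hy⟩ := Nat.sSup_mem (range_nonempty _) (bddAbove_wordCount_fiber (Ω := Ω) M)
    refine le_iSup_of_le y ?_
    have := le_logCovering_subshift hΩ (hS y) M hε'
    rw [himg] at this
    rw [pointFiberCount, iSup, ← hy]
    exact this
  · refine (logCovering_subshift_le hΩ (hS y) M hK.le).trans ?_
    rw [himg, EReal.coe_le_coe_iff]
    refine Real.log_le_log ?_ (by exact_mod_cast wordCount_fiber_le y.2 _)
    exact_mod_cast one_le_wordCount (fiber_nonempty y.2) _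

end Subshift

/-! ### The weighted metric on the cube -/

section CubeDist

theorem hasSum_half_pow_succ (K : ℕ) :
    HasSum (fun n : ℕ => (1 / 2 : ℝ) ^ (n + K + 1)) ((1 / 2) ^ K) := by
  have h := hasSum_geometric_two.mul_left ((1 / 2 : ℝ) ^ (K + 1))
  have h1 : (1 / 2 : ℝ) ^ (K + 1) * 2 = (1 / 2) ^ K := by rw [pow_succ]; ring
  rw [h1] at h
  refine h.congr_fun fun n => ?_
  simp only [one_div]
  ring

theorem abs_unitInterval_sub_le_one (s t : unitInterval) : |(s : ℝ) - t| ≤ 1 := by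
  rw [abs_le]
  constructor <;> linarith [s.2.1, s.2.2, t.2.1, t.2.2]

theorem cubeDist_term_nonneg (p q : CubePair) (n : ℕ) :
    0 ≤ (1 / 2 : ℝ) ^ (n + 1) * max |(p.1 n : ℝ) - q.1 n| |(p.2 n : ℝ) - q.2 n| :=
  mul_nonneg (by positivity) (le_max_of_le_left (abs_nonneg _))

theorem cubeDist_term_le (p q : CubePair) (n : ℕ) :
    (1 / 2 : ℝ) ^ (n + 1) * max |(p.1 n : ℝ) - q.1 n| |(p.2 n : ℝ) - q.2 n| ≤
      (1 / 2) ^ (n + 1) :=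
  mul_le_of_le_one_right (by positivity)
    (max_le (abs_unitInterval_sub_le_one _ _) (abs_unitInterval_sub_le_one _ _))

theorem summable_cubeDist (p q : CubePair) : Summable fun n : ℕ =>
    (1 / 2 : ℝ) ^ (n + 1) * max |(p.1 n : ℝ) - q.1 n| |(p.2 n : ℝ) - q.2 n| :=
  (hasSum_half_pow_succ 0).summable.of_nonneg_of_le (cubeDist_term_nonneg p q)
    (cubeDist_term_le p q)

theorem max_abs_sub_zero_le_cubeDist (p q : CubePair) :
    max |(p.1 0 : ℝ) - q.1 0| |(p.2 0 : ℝ) - q.2 0| ≤ 2 * cubeDist p q := by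
  have h := (summable_cubeDist p q).le_tsum 0 fun n _ => cubeDist_term_nonneg p q n
  rw [cubeDist]
  rw [zero_add, pow_one] at h
  linarith

/-- The first `K` weights sum to at most one, and the tail of the weights is `2 ^ (-K)`. -/
theorem cubeDist_le_add {p q : CubePair} {K : ℕ} {δ : ℝ} (hδ : 0 ≤ δ)
    (h : ∀ n < K, max |(p.1 n : ℝ) - q.1 n| |(p.2 n : ℝ) - q.2 n| ≤ δ) :
    cubeDist p q ≤ δ + (1 / 2) ^ K := by
  rw [cubeDist, ← (summable_cubeDist p q).sum_add_tsum_nat_add K]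
  refine add_le_add ?_ ?_
  · have h1 : ∑ n ∈ Finset.range K, (1 / 2 : ℝ) ^ (n + 1) ≤ 1 := by
      have := (hasSum_half_pow_succ 0).summable.sum_le_tsum (Finset.range K)
        (fun n _ => by positivity)
      rwa [(hasSum_half_pow_succ 0).tsum_eq, pow_zero] at this
    calc _ ≤ ∑ n ∈ Finset.range K, (1 / 2 : ℝ) ^ (n + 1) * δ :=
          Finset.sum_le_sum fun n hn =>
            mul_le_mul_of_nonneg_left (h n (Finset.mem_range.1 hn)) (by positivity)
      _ = (∑ n ∈ Finset.range K, (1 / 2 : ℝ) ^ (n + 1)) * δ := by rw [Finset.sum_mul]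
      _ ≤ δ := mul_le_of_le_one_left hδ h1
  · rw [← (hasSum_half_pow_succ K).tsum_eq]
    exact ((summable_nat_add_iff K).2 (summable_cubeDist p q)).tsum_le_tsum
      (fun n => cubeDist_term_le p q (n + K)) (hasSum_half_pow_succ K).summable

theorem cubeDist_le_one (p q : CubePair) : cubeDist p q ≤ 1 := by
  have := cubeDist_le_add (p := p) (q := q) (K := 0) le_rfl (by simp)
  simpa using this

theorem cubeDist_comm (p q : CubePair) : cubeDist p q = cubeDist q p := by
  simp only [cubeDist, abs_sub_comm]

theorem cubeDist_triangle (p q r : CubePair) : cubeDist p r ≤ cubeDist p q + cubeDist q r := by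
  rw [cubeDist, cubeDist, cubeDist, ← (summable_cubeDist p q).tsum_add (summable_cubeDist q r)]
  refine (summable_cubeDist p r).tsum_le_tsum (fun n => ?_)
    ((summable_cubeDist p q).add (summable_cubeDist q r))
  rw [← mul_add]
  refine mul_le_mul_of_nonneg_left (max_le ?_ ?_) (by positivity)
  · exact (abs_sub_le _ _ _).trans (add_le_add (le_max_left _ _) (le_max_left _ _))
  · exact (abs_sub_le _ _ _).trans (add_le_add (le_max_right _ _) (le_max_right _ _))

theorem continuous_cubeDist (p : CubePair) : Continuous (cubeDist p) := by
  refine continuous_tsum (fun n => ?_) (hasSum_half_pow_succ 0).summable (fun n q => ?_)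
  · fun_prop
  · rw [Real.norm_of_nonneg (cubeDist_term_nonneg p q n)]
    exact cubeDist_term_le p q n

end CubeDist

/-! ### Digit expansions and grid cells -/

section Digits

/-- The integer with base `a` expansion given by the first `k` digits of `c`. -/
def digitIndex {a : ℕ} (c : ℕ → Fin a) : ℕ → ℕ
  | 0 => 0
  | k + 1 => a * digitIndex c k + c k

theorem digitIndex_lt {a : ℕ} (c : ℕ → Fin a) (k : ℕ) : digitIndex c k < a ^ k := by
  induction k with
  | zero => simp [digitIndex]
  | succ k ih =>
    rw [digitIndex, pow_succ']
    have h1 := (c k).2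
    have h2 : a * (digitIndex c k + 1) ≤ a * a ^ k := Nat.mul_le_mul_left _ ih
    rw [mul_add] at h2
    omega

theorem digitIndex_inj {a : ℕ} {c c' : ℕ → Fin a} {k : ℕ}
    (h : digitIndex c k = digitIndex c' k) {m : ℕ} (hm : m < k) : c m = c' m := by
  induction k with
  | zero => omega
  | succ k ih =>
    rw [digitIndex, digitIndex] at h
    have h1 : (c k : ℕ) = c' k := by
      have := congrArg (· % a) h
      simpa [Nat.mod_eq_of_lt (c k).2, Nat.mod_eq_of_lt (c' k).2] using this
    have h2 : digitIndex c k = digitIndex c' k := by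
      have ha : 0 < a := Fin.pos (c 0)
      rw [h1] at h
      exact Nat.eq_of_mul_eq_mul_left ha (Nat.add_right_cancel h)
    rcases Nat.lt_succ_iff_lt_or_eq.1 hm with h3 | rfl
    · exact ih h2 h3
    · exact Fin.ext h1

theorem pow_mul_sum_ofDigitsTerm {a : ℕ} (c : ℕ → Fin a) (k : ℕ) :
    (a : ℝ) ^ k * ∑ i ∈ Finset.range k, Real.ofDigitsTerm c i = digitIndex c k := by
  have ha : (a : ℝ) ≠ 0 := by
    have := Fin.pos (c 0)
    positivity
  induction k with
  | zero => simp [digitIndex]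
  | succ k ih =>
    rw [Finset.sum_range_succ, mul_add, pow_succ', mul_assoc, ih, Real.ofDigitsTerm, ← pow_succ',
      mul_left_comm, mul_inv_cancel₀ (by positivity), mul_one, digitIndex]
    push_cast
    ring

theorem digitIndex_le_pow_mul_ofDigits {a : ℕ} (c : ℕ → Fin a) (k : ℕ) :
    (digitIndex c k : ℝ) ≤ a ^ k * Real.ofDigits c ∧
      (a : ℝ) ^ k * Real.ofDigits c ≤ digitIndex c k + 1 := by
  have ha : (a : ℝ) ≠ 0 := by
    have := Fin.pos (c 0)
    positivity
  rw [Real.ofDigits_eq_sum_add_ofDigits c k, mul_add, pow_mul_sum_ofDigitsTerm, ← mul_assoc,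
    mul_inv_cancel₀ (by positivity), one_mul]
  constructor <;>
    linarith [Real.ofDigits_nonneg fun i => c (i + k), Real.ofDigits_le_one fun i => c (i + k)]

/-- After scaling by `a ^ k` the two points are at distance at most two, and the index is within one
below its point, so six integers remain. The form `2 * R` matches the factor lost in
`max_abs_sub_le_bowenDist`. -/
theorem digitIndex_mem_Icc {a : ℕ} {c : ℕ → Fin a} {k : ℕ} {t R : ℝ} (ht : 0 ≤ t)
    (h : |t - Real.ofDigits c| ≤ 2 * R) (hR : R ≤ ((a : ℝ) ^ k)⁻¹) :
    digitIndex c k ∈ Finset.Icc (⌊(a : ℝ) ^ k * t⌋₊ - 3) (⌊(a : ℝ) ^ k * t⌋₊ + 2) := by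
  have ha : (0 : ℝ) < a := by exact_mod_cast Fin.pos (c 0)
  have hpos : (0 : ℝ) < (a : ℝ) ^ k := by positivity
  obtain ⟨h1, h2⟩ := digitIndex_le_pow_mul_ofDigits c k
  have h3 : |(a : ℝ) ^ k * t - a ^ k * Real.ofDigits c| ≤ 2 := by
    rw [← mul_sub, abs_mul, abs_of_pos hpos]
    calc (a : ℝ) ^ k * |t - Real.ofDigits c| ≤ a ^ k * (2 * ((a : ℝ) ^ k)⁻¹) := by
          gcongr
          linarith
      _ = 2 := by field_simp
  rw [abs_le] at h3
  have h4 := Nat.lt_floor_add_one ((a : ℝ) ^ k * t)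
  have h5 := Nat.floor_le (mul_nonneg hpos.le ht)
  rw [Finset.mem_Icc]
  constructor
  · have : (⌊(a : ℝ) ^ k * t⌋₊ : ℝ) ≤ ((digitIndex c k + 3 : ℕ) : ℝ) := by
      push_cast
      linarith
    have := Nat.cast_le.1 this
    omega
  · have : (digitIndex c k : ℝ) < ((⌊(a : ℝ) ^ k * t⌋₊ + 3 : ℕ) : ℝ) := by
      push_cast
      linarith
    have := Nat.cast_lt.1 this
    omega

end Digits

/-! ### Codings of carpet points and Bowen balls -/

section Carpet

variable {a b : ℕ} {Ω : Set (ℕ → Fin a × Fin b)}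

/-- `w` is a coding of the point `p` of the carpet. -/
def IsCode (p : carpet Ω) (w : ℕ → ℕ → Fin a × Fin b) : Prop :=
  (∀ m, w m ∈ Ω) ∧ ∀ n, (p.1.1 n : ℝ) = Real.ofDigits (fun m => (w m n).1) ∧
    (p.1.2 n : ℝ) = Real.ofDigits (fun m => (w m n).2)

theorem exists_isCode (p : carpet Ω) : ∃ w, IsCode p w := by
  obtain ⟨w, hw, hp⟩ := p.2
  exact ⟨w, hw, hp⟩

theorem exists_carpet_isCode {w : ℕ → ℕ → Fin a × Fin b} (hw : ∀ m, w m ∈ Ω) :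
    ∃ p : carpet Ω, IsCode p w := by
  refine ⟨⟨(fun n => ⟨Real.ofDigits (fun m => (w m n).1), Real.ofDigits_nonneg _,
    Real.ofDigits_le_one _⟩, fun n => ⟨Real.ofDigits (fun m => (w m n).2),
    Real.ofDigits_nonneg _, Real.ofDigits_le_one _⟩), w, hw, fun n => ⟨?_, ?_⟩⟩,
    hw, fun n => ⟨rfl, rfl⟩⟩
  · exact tsum_congr fun m => (div_eq_mul_inv _ _).symm
  · exact tsum_congr fun m => (div_eq_mul_inv _ _).symm

theorem coe_carpetShift_iterate (hΩ : MapsTo shift Ω Ω) (p : carpet Ω) (m n : ℕ) :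
    ((carpetShift hΩ)^[m] p).1.1 n = p.1.1 (n + m) ∧
      ((carpetShift hΩ)^[m] p).1.2 n = p.1.2 (n + m) := by
  induction m generalizing n with
  | zero => exact ⟨rfl, rfl⟩
  | succ m ih =>
    rw [Function.iterate_succ_apply']
    have h : n + (m + 1) = n + 1 + m := by ring
    rw [h]
    exact ih (n + 1)

theorem continuous_carpetShift_iterate (hΩ : MapsTo shift Ω Ω) (m : ℕ) :
    Continuous ((carpetShift hΩ)^[m]) := by
  refine Continuous.subtype_mk (f := fun p => ((carpetShift hΩ)^[m] p).1) ?_ _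
  have h : (fun p : carpet Ω => ((carpetShift hΩ)^[m] p).1) =
      fun p => (fun n => p.1.1 (n + m), fun n => p.1.2 (n + m)) := by
    funext p
    exact Prod.ext (funext fun n => (coe_carpetShift_iterate hΩ p m n).1)
      (funext fun n => (coe_carpetShift_iterate hΩ p m n).2)
  rw [h]
  fun_prop

theorem isOpen_carpet_ball (hΩ : MapsTo shift Ω Ω) (M : ℕ) (p : carpet Ω) (r : ℝ) :
    IsOpen {q : carpet Ω | ∀ m < M,
      carpetDist Ω ((carpetShift hΩ)^[m] p) ((carpetShift hΩ)^[m] q) < r} := by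
  have : {q : carpet Ω | ∀ m < M,
      carpetDist Ω ((carpetShift hΩ)^[m] p) ((carpetShift hΩ)^[m] q) < r} =
      ⋂ m ∈ Finset.range M, {q : carpet Ω |
        carpetDist Ω ((carpetShift hΩ)^[m] p) ((carpetShift hΩ)^[m] q) < r} := by
    ext q
    simp
  rw [this]
  refine isOpen_biInter_finset fun m _ => isOpen_lt ?_ continuous_const
  exact (continuous_cubeDist _).comp
    (continuous_subtype_val.comp (continuous_carpetShift_iterate hΩ m))

theorem max_abs_sub_le_bowenDist (hΩ : MapsTo shift Ω Ω) {M n : ℕ} (hn : n < M)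
    (p q : carpet Ω) : max |(p.1.1 n : ℝ) - q.1.1 n| |(p.1.2 n : ℝ) - q.1.2 n| ≤
      2 * bowenDist (carpetDist Ω) (carpetShift hΩ) M p q := by
  have h1 := le_bowenDist (d := carpetDist Ω) (T := carpetShift hΩ) p q hn
  have h2 := max_abs_sub_zero_le_cubeDist ((carpetShift hΩ)^[n] p).1 ((carpetShift hΩ)^[n] q).1
  rw [(coe_carpetShift_iterate hΩ p n 0).1, (coe_carpetShift_iterate hΩ p n 0).2,
    (coe_carpetShift_iterate hΩ q n 0).1, (coe_carpetShift_iterate hΩ q n 0).2, zero_add] at h2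
  exact h2.trans (mul_le_mul_of_nonneg_left h1 zero_le_two)

theorem carpetDist_iterate_le (hΩ : MapsTo shift Ω Ω) {M K : ℕ} {p q : carpet Ω} {δ : ℝ}
    (hδ : 0 ≤ δ) (h : ∀ n < M + K,
      max |(p.1.1 n : ℝ) - q.1.1 n| |(p.1.2 n : ℝ) - q.1.2 n| ≤ δ) {m : ℕ} (hm : m < M) :
    carpetDist Ω ((carpetShift hΩ)^[m] p) ((carpetShift hΩ)^[m] q) ≤ δ + (1 / 2) ^ K := by
  refine cubeDist_le_add hδ fun n hn => ?_
  rw [(coe_carpetShift_iterate hΩ p m n).1, (coe_carpetShift_iterate hΩ p m n).2,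
    (coe_carpetShift_iterate hΩ q m n).1, (coe_carpetShift_iterate hΩ q m n).2]
  exact h _ (by omega)

theorem max_abs_sub_le_of_isCode {p q : carpet Ω} {w w' : ℕ → ℕ → Fin a × Fin b}
    (hp : IsCode p w) (hq : IsCode q w') {k L n : ℕ} {δ : ℝ} (hk : ((a : ℝ) ^ k)⁻¹ ≤ δ)
    (hL : ((b : ℝ) ^ L)⁻¹ ≤ δ) (h1 : ∀ m < k, (w m n).1 = (w' m n).1)
    (h2 : ∀ m < L, (w m n).2 = (w' m n).2) :
    max |(p.1.1 n : ℝ) - q.1.1 n| |(p.1.2 n : ℝ) - q.1.2 n| ≤ δ := by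
  rw [(hp.2 n).1, (hp.2 n).2, (hq.2 n).1, (hq.2 n).2]
  exact max_le ((Real.abs_ofDigits_sub_ofDigits_le h1).trans hk)
    ((Real.abs_ofDigits_sub_ofDigits_le h2).trans hL)

theorem bowenDist_carpet_le_one (hΩ : MapsTo shift Ω Ω) (M : ℕ) (p q : carpet Ω) :
    bowenDist (carpetDist Ω) (carpetShift hΩ) M p q ≤ 1 :=
  bowenDist_le zero_le_one fun _ _ => cubeDist_le_one _ _

/-- The indices, at each time `n < N`, of the first `k` horizontal and the first `L` vertical
digits of a coding. -/
def indexVec (k L N : ℕ) (w : ℕ → ℕ → Fin a × Fin b) : Fin N → ℕ × ℕ := fun n =>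
  (digitIndex (fun m => (w m n).1) k, digitIndex (fun m => (w m n).2) L)

theorem indexVec_fst_inj {k L N : ℕ} {w w' : ℕ → ℕ → Fin a × Fin b}
    (h : indexVec k L N w = indexVec k L N w') {m n : ℕ} (hm : m < k) (hn : n < N) :
    (w m n).1 = (w' m n).1 :=
  digitIndex_inj (congrArg Prod.fst (congrFun h ⟨n, hn⟩)) hm

theorem indexVec_snd_inj {k L N : ℕ} {w w' : ℕ → ℕ → Fin a × Fin b}
    (h : indexVec k L N w = indexVec k L N w') {m n : ℕ} (hm : m < L) (hn : n < N) :
    (w m n).2 = (w' m n).2 :=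
  digitIndex_inj (congrArg Prod.snd (congrFun h ⟨n, hn⟩)) hm

/-- Every coding of every point of the ball is covered, so non-unique expansions do no harm. At each
time below `M` there are `6 * 6` possible cells. The last `K` times are unconstrained and contribute
a factor independent of `M`. -/
theorem exists_finset_indexVec (hΩ : MapsTo shift Ω Ω) (M K : ℕ) {k L : ℕ} {R : ℝ}
    (hk : R ≤ ((a : ℝ) ^ k)⁻¹) (hL : R ≤ ((b : ℝ) ^ L)⁻¹) (p : carpet Ω) :
    ∃ F : Finset (Fin (M + K) → ℕ × ℕ), F.card ≤ 36 ^ M * (a ^ k * b ^ L) ^ K ∧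
      ∀ q w, IsCode q w → bowenDist (carpetDist Ω) (carpetShift hΩ) M p q ≤ R →
        indexVec k L (M + K) w ∈ F := by
  let I : (c : ℕ) → (t : ℝ) → Finset ℕ := fun c t => Finset.Icc (⌊(c : ℝ) * t⌋₊ - 3)
    (⌊(c : ℝ) * t⌋₊ + 2)
  have hI : ∀ c t, (I c t).card ≤ 6 := fun c t => by
    rw [Nat.card_Icc]
    omega
  refine ⟨Fintype.piFinset fun n : Fin (M + K) => if (n : ℕ) < M then
    I (a ^ k) (p.1.1 n) ×ˢ I (b ^ L) (p.1.2 n) else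
    Finset.range (a ^ k) ×ˢ Finset.range (b ^ L), ?_, ?_⟩
  · rw [Fintype.card_piFinset, Fin.prod_univ_add]
    refine Nat.mul_le_mul ?_ ?_
    · calc _ ≤ ∏ _i : Fin M, 36 := Finset.prod_le_prod' fun i _ => ?_
        _ = 36 ^ M := by simp
      rw [if_pos (by simp), Finset.card_product]
      exact Nat.mul_le_mul (hI _ _) (hI _ _)
    · simp
  · intro q w hq hd
    rw [Fintype.mem_piFinset]
    intro n
    split_ifs with hn
    · have h := (max_abs_sub_le_bowenDist hΩ hn p q).trans
        (mul_le_mul_of_nonneg_left hd zero_le_two)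
      rw [(hq.2 n).1, (hq.2 n).2] at h
      refine Finset.mem_product.2 ⟨?_, ?_⟩
      · have := digitIndex_mem_Icc (p.1.1 n).2.1 ((le_max_left _ _).trans h) hk
        simpa only [I, indexVec, Nat.cast_pow] using this
      · have := digitIndex_mem_Icc (p.1.2 n).2.1 ((le_max_right _ _).trans h) hL
        simpa only [I, indexVec, Nat.cast_pow] using this
    · exact Finset.mem_product.2 ⟨Finset.mem_range.2 (digitIndex_lt _ _),
        Finset.mem_range.2 (digitIndex_lt _ _)⟩

end Carpet

/-! ### Counting words level by level -/

section Counting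

theorem prod_levels (D n n' : ℕ) {k L k' L' : ℕ} (hkL : k ≤ L) (hkL' : k' ≤ L') :
    ∏ m : Fin L', (if (m : ℕ) < k then 1 else if (m : ℕ) < L then (if (m : ℕ) < k' then D else 1)
      else if (m : ℕ) < k' then n else n') =
      D ^ (min L k' - k) * n ^ (k' - L) * n' ^ (L' - max L k') := by
  rw [Fin.prod_univ_eq_prod_range (fun m => if m < k then 1 else if m < L then
    (if m < k' then D else 1) else if m < k' then n else n')]
  have h : ∀ m ∈ Finset.range L', (if m < k then 1 else if m < L then
      (if m < k' then D else 1) else if m < k' then n else n') =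
      (if m ∈ Finset.Ico k (min L k') then D else 1) * (if m ∈ Finset.Ico L k' then n else 1) *
        (if m ∈ Finset.Ico (max L k') L' then n' else 1) := by
    intro m hm
    rw [Finset.mem_range] at hm
    simp only [Finset.mem_Ico, lt_min_iff, max_le_iff]
    split_ifs <;> omega
  rw [Finset.prod_congr rfl h, Finset.prod_mul_distrib, Finset.prod_mul_distrib]
  have hpow : ∀ (s t x : ℕ), t ≤ L' →
      ∏ m ∈ Finset.range L', (if m ∈ Finset.Ico s t then x else 1) = x ^ (t - s) := by
    intro s t x ht
    rw [Finset.prod_ite_mem, Finset.inter_eq_right.2, Finset.prod_const, Nat.card_Ico]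
    intro m hm
    exact Finset.mem_range.2 ((Finset.mem_Ico.1 hm).2.trans_le ht)
  rw [hpow _ _ _ (by omega), hpow _ _ _ hkL', hpow _ _ _ le_rfl]

theorem ncard_image_le_card_mul {β γ δ : Type*} [Finite δ] {S : Set β} {f : β → γ}
    {F : Finset γ} (hf : ∀ x ∈ S, f x ∈ F) (g : β → δ) {n : ℕ}
    (h : ∀ t ∈ F, (g '' {x | x ∈ S ∧ f x = t}).ncard ≤ n) : (g '' S).ncard ≤ F.card * n := by
  classical
  have hsub : (g '' S) ⊆ (F.biUnion fun t =>
      (Set.toFinite (g '' {x | x ∈ S ∧ f x = t})).toFinset : Finset δ) := by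
    rintro _ ⟨x, hx, rfl⟩
    simp only [Finset.coe_biUnion, Set.Finite.coe_toFinset, Set.mem_iUnion]
    exact ⟨f x, hf x hx, x, ⟨hx, rfl⟩, rfl⟩
  refine (Set.ncard_le_ncard hsub).trans ?_
  rw [Set.ncard_coe_finset]
  refine Finset.card_biUnion_le_card_mul _ _ _ fun t ht => ?_
  rw [← Set.ncard_eq_toFinset_card]
  exact h t ht

variable {a b : ℕ} {Ω : Set (ℕ → Fin a × Fin b)}

/-- The number of choices for words of length `N` at the levels below `L'`, given the horizontal
letters below level `k` and the vertical ones below level `L`, when the horizontal letters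
are recorded only below level `k'`. -/
noncomputable def blockCount (Ω : Set (ℕ → Fin a × Fin b)) (N k L k' L' : ℕ) : ℕ :=
  fiberCount Ω N ^ (min L k' - k) * wordCount Ω N ^ (k' - L) *
    wordCount (proj '' Ω) N ^ (L' - max L k')

theorem one_le_blockCount (hne : Ω.Nonempty) (N k L k' L' : ℕ) :
    1 ≤ blockCount Ω N k L k' L' := by
  have h1 := one_le_fiberCount hne N
  have h2 := one_le_wordCount hne N
  have h3 := one_le_wordCount (hne.image proj) N
  rw [blockCount]
  exact Nat.succ_le_of_lt (by positivity)

theorem log_blockCount (hne : Ω.Nonempty) (N k L k' L' : ℕ) :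
    Real.log (blockCount Ω N k L k' L') =
      (min L k' - k : ℕ) * Real.log (fiberCount Ω N) + (k' - L : ℕ) * Real.log (wordCount Ω N) +
        (L' - max L k' : ℕ) * Real.log (wordCount (proj '' Ω) N) := by
  have h1 : (0 : ℝ) < fiberCount Ω N := by exact_mod_cast one_le_fiberCount hne N
  have h2 : (0 : ℝ) < wordCount Ω N := by exact_mod_cast one_le_wordCount hne N
  have h3 : (0 : ℝ) < wordCount (proj '' Ω) N := by
    exact_mod_cast one_le_wordCount (hne.image proj) N
  rw [blockCount]
  push_cast
  rw [Real.log_mul (by positivity) (by positivity), Real.log_mul (by positivity) (by positivity),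
    Real.log_pow, Real.log_pow, Real.log_pow]

/-- The words of length `N` at the levels below `L'`, with horizontal letters replaced by `z` from
level `k'` on. -/
def blockCode (z : Fin a) (k' L' N : ℕ) (w : ℕ → ℕ → Fin a × Fin b) :
    Fin L' → Fin N → Fin a × Fin b :=
  fun m n => if (m : ℕ) < k' then w m n else (z, (w m n).2)

/-- Equal index vectors force equal horizontal letters below level `k` and equal vertical ones below
`L`. Hence the rows range independently over at most the sets `S m`, whose sizes multiply to
`blockCount`. -/
theorem ncard_blockCode_image_le (z : Fin a) (N : ℕ) {k L k' L' : ℕ} (hkL : k ≤ L)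
    (hkL' : k' ≤ L') {P : Set (ℕ → ℕ → Fin a × Fin b)} (hP : ∀ w ∈ P, ∀ m, w m ∈ Ω)
    (t : Fin N → ℕ × ℕ) :
    (blockCode z k' L' N '' {w | w ∈ P ∧ indexVec k L N w = t}).ncard ≤
      blockCount Ω N k L k' L' := by
  classical
  rcases Set.eq_empty_or_nonempty {w | w ∈ P ∧ indexVec k L N w = t} with hemp | ⟨w₀, hw₀, ht⟩
  · rw [hemp]
    simp
  let S : ℕ → Set (Fin N → Fin a × Fin b) := fun m =>
    if m < k then {restr N fun n => if m < k' then w₀ m n else (z, (w₀ m n).2)}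
    else if m < L then
      (if m < k' then fiberWords Ω (restr N (proj (w₀ m))) else {restr N fun n => (z, (w₀ m n).2)})
    else if m < k' then words Ω N else (fun u n => (z, (u n).2)) '' words Ω N
  have hsub : blockCode z k' L' N '' {w | w ∈ P ∧ indexVec k L N w = t} ⊆
      (Fintype.piFinset fun m : Fin L' => (Set.toFinite (S m)).toFinset : Finset _) := by
    rintro _ ⟨w, ⟨hw, hwt⟩, rfl⟩
    rw [Finset.mem_coe, Fintype.mem_piFinset]
    intro m
    rw [Set.Finite.mem_toFinset]
    have heq : indexVec k L N w = indexVec k L N w₀ := hwt.trans ht.symm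
    have h1 : (m : ℕ) < k → ∀ n : Fin N, (w m n).1 = (w₀ m n).1 := fun hm n =>
      indexVec_fst_inj heq hm n.2
    have h2 : (m : ℕ) < L → ∀ n : Fin N, (w m n).2 = (w₀ m n).2 := fun hm n =>
      indexVec_snd_inj heq hm n.2
    have hmem : restr N (w m) ∈ words Ω N := ⟨_, hP w hw m, rfl⟩
    simp only [S]
    by_cases hk' : (m : ℕ) < k'
    · have hcode : blockCode z k' L' N w m = restr N (w m) := by
        funext n
        simp [blockCode, hk', restr]
      rw [hcode]
      simp only [hk', if_true]
      split_ifs with hm hm'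
      · exact funext fun n => Prod.ext (h1 hm n) (h2 (hm.trans_le hkL) n)
      · exact ⟨hmem, fun n => h2 hm' n⟩
      · exact hmem
    · have hcode : blockCode z k' L' N w m = fun n : Fin N => (z, (w m n).2) := by
        funext n
        simp [blockCode, hk']
      rw [hcode]
      simp only [hk', if_false]
      split_ifs with hm hm'
      · exact funext fun n => Prod.ext rfl (h2 (hm.trans_le hkL) n)
      · exact funext fun n => Prod.ext rfl (h2 hm' n)
      · exact ⟨_, hmem, rfl⟩
  refine (Set.ncard_le_ncard hsub).trans ?_
  rw [Set.ncard_coe_finset, Fintype.card_piFinset, blockCount, ← prod_levels _ _ _ hkL hkL']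
  refine Finset.prod_le_prod' fun m _ => ?_
  rw [← Set.ncard_eq_toFinset_card]
  simp only [S]
  split_ifs
  · simp
  · simp
  · exact ncard_fiberWords_le _
  · simp
  · exact le_rfl
  -- With the horizontal letter frozen at `z`, only the projected word is left to count.
  · have : (fun (u : Fin N → Fin a × Fin b) n => (z, (u n).2)) '' words Ω N =
        (fun v n => (z, v n)) '' words (proj '' Ω) N := by
      rw [← image_snd_words, Set.image_image]
    rw [this]
    exact Set.ncard_image_le

theorem log_pow_mul_pow (M K : ℕ) {q : ℝ} (hq : 0 < q) :
    Real.log (36 ^ M * q ^ K) = M * Real.log 36 + K * Real.log q := by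
  rw [Real.log_mul (by positivity) (by positivity), Real.log_pow, Real.log_pow]

/-- Each point is coded by the block code of a chosen coding. Equal codes mean closeness below `ρ /
2`, so the covering sets are Bowen balls of that radius. The number of codes is at most index
vectors times block codes per vector. -/
theorem logCovering_ball_le (ha : 0 < a) (hb : 0 < b) (hne : Ω.Nonempty) (hΩ : MapsTo shift Ω Ω)
    {k L k' L' K : ℕ} (hkL : k ≤ L) (hkL' : k' ≤ L') {r ρ δ : ℝ} (hk : r ≤ ((a : ℝ) ^ k)⁻¹)
    (hL : r ≤ ((b : ℝ) ^ L)⁻¹) (hk' : ((a : ℝ) ^ k')⁻¹ ≤ δ) (hL' : ((b : ℝ) ^ L')⁻¹ ≤ δ)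
    (hρ : δ + (1 / 2) ^ K < ρ / 2) (M : ℕ) (x : carpet Ω) :
    logCovering (carpetDist Ω) (carpetShift hΩ) M
      (bowenBall (carpetDist Ω) (carpetShift hΩ) M x r) ρ ≤
      ((M * Real.log 36 + K * Real.log (a ^ k * b ^ L) +
        Real.log (blockCount Ω (M + K) k L k' L') : ℝ) : EReal) := by
  choose w hw using exists_isCode (Ω := Ω)
  have hδ : 0 ≤ δ := le_trans (by positivity) hk'
  have hρ0 : 0 < ρ := by
    have : (0 : ℝ) < (1 / 2) ^ K := by positivity
    linarith
  have hQ : (0 : ℝ) < 36 ^ M * (a ^ k * b ^ L) ^ K := by positivity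
  have hB : (1 : ℝ) ≤ blockCount Ω (M + K) k L k' L' := by
    exact_mod_cast one_le_blockCount hne _ _ _ _ _
  have hlog : M * Real.log 36 + K * Real.log (a ^ k * b ^ L) +
      Real.log (blockCount Ω (M + K) k L k' L') =
      Real.log (((36 ^ M * (a ^ k * b ^ L) ^ K * blockCount Ω (M + K) k L k' L' : ℕ)) : ℝ) := by
    push_cast
    rw [Real.log_mul hQ.ne' (by positivity), log_pow_mul_pow M K (by positivity)]
  rw [hlog]
  refine logCovering_le_of_code (fun p => blockCode ⟨0, ha⟩ k' L' (M + K) (w p))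
    (fun p => {q : carpet Ω | ∀ m < M,
      carpetDist Ω ((carpetShift hΩ)^[m] p) ((carpetShift hΩ)^[m] q) < ρ / 2})
    (fun p => isOpen_carpet_ball hΩ M p _) ?_ ?_ ?_ ?_
  · intro p q hq q' hq'
    refine bowenDist_le hρ0.le fun m hm => ?_
    have h1 := hq m hm
    have h2 := hq' m hm
    rw [carpetDist, cubeDist_comm] at h1
    exact (cubeDist_triangle _ _ _).trans ((add_lt_add h1 h2).le.trans (by linarith))
  · intro p _ q _ hpq m hm
    refine (carpetDist_iterate_le hΩ hδ (fun n hn => ?_) hm).trans_lt hρ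
    have hc : ∀ i < L', (if i < k' then w p i n else (⟨0, ha⟩, (w p i n).2)) =
        (if i < k' then w q i n else (⟨0, ha⟩, (w q i n).2)) := fun i hi =>
      congrFun (congrFun hpq ⟨i, hi⟩) ⟨n, hn⟩
    refine max_abs_sub_le_of_isCode (hw p) (hw q) hk' hL' (fun i hi => ?_) (fun i hi => ?_)
    · have := hc i (hi.trans_le hkL')
      rw [if_pos hi, if_pos hi] at this
      exact congrArg Prod.fst this
    · have := congrArg Prod.snd (hc i hi)
      split_ifs at this <;> exact this
  · exact_mod_cast Nat.one_le_iff_ne_zero.2 (Nat.mul_ne_zero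
      (by positivity) (Nat.one_le_iff_ne_zero.1 (one_le_blockCount hne _ _ _ _ _)))
  · rw [Nat.cast_le]
    obtain ⟨F, hF, hmem⟩ := exists_finset_indexVec hΩ M K hk hL x
    have himg : (fun p => blockCode ⟨0, ha⟩ k' L' (M + K) (w p)) ''
        bowenBall (carpetDist Ω) (carpetShift hΩ) M x r =
        blockCode ⟨0, ha⟩ k' L' (M + K) ''
          (w '' bowenBall (carpetDist Ω) (carpetShift hΩ) M x r) := by
      rw [Set.image_image]
    rw [himg]
    refine (ncard_image_le_card_mul (f := indexVec k L (M + K)) (F := F)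
      (n := blockCount Ω (M + K) k L k' L') ?_ _ fun t _ => ?_).trans (Nat.mul_le_mul_right _ hF)
    · rintro _ ⟨q, hq, rfl⟩
      exact hmem q _ (hw q) hq
    · refine ncard_blockCode_image_le _ _ hkL hkL' ?_ t
      rintro _ ⟨q, hq, rfl⟩
      exact (hw q).1

/-- The centre has all rows equal to `z`, a point over which the fibre of words is largest. Varying
each row as freely as the radius permits gives `blockCount` points of the ball. A set of diameter
`ρ` contains few of them, because a configuration is recovered from its index vector. -/
theorem le_logCovering_ball (ha : 0 < a) (hb : 0 < b) (hne : Ω.Nonempty) (hΩ : MapsTo shift Ω Ω)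
    {k L k' L' K : ℕ} (hkL : k ≤ L) (hkL' : k' ≤ L') {r ρ δ : ℝ} (hk : ((a : ℝ) ^ k)⁻¹ ≤ δ)
    (hL : ((b : ℝ) ^ L)⁻¹ ≤ δ) (hr : δ + (1 / 2) ^ K ≤ r) (hk' : ρ ≤ ((a : ℝ) ^ k')⁻¹)
    (hL' : ρ ≤ ((b : ℝ) ^ L')⁻¹) (M : ℕ) :
    ∃ x : carpet Ω, ((Real.log (blockCount Ω (M + K) k L k' L') -
      (M * Real.log 36 + K * Real.log (a ^ k' * b ^ L')) : ℝ) : EReal) ≤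
      logCovering (carpetDist Ω) (carpetShift hΩ) M
        (bowenBall (carpetDist Ω) (carpetShift hΩ) M x r) ρ := by
  classical
  have hδ : 0 ≤ δ := le_trans (by positivity) hk
  set N := M + K with hN
  obtain ⟨z, hz, hzN⟩ := exists_ncard_fiberWords_eq hne N
  -- One word of `Ω` above each projected word: in rows from `k'` on, horizontal letters are
  -- invisible at scale `ρ` and must be determined by the vertical ones.
  obtain ⟨sec, hsec, hbij⟩ := Set.exists_subset_bijOn (words Ω N)
    (fun (u : Fin N → Fin a × Fin b) i => (u i).2)
  rw [image_snd_words] at hbij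
  let S : ℕ → Set (Fin N → Fin a × Fin b) := fun m =>
    if m < k then {restr N z}
    else if m < L then (if m < k' then fiberWords Ω (restr N (proj z)) else {restr N z})
    else if m < k' then words Ω N else sec
  have hzw : restr N z ∈ words Ω N := ⟨z, hz, rfl⟩
  have hSw : ∀ m, S m ⊆ words Ω N := by
    intro m
    simp only [S]
    split_ifs
    · exact Set.singleton_subset_iff.2 hzw
    · exact fun u hu => hu.1
    · exact Set.singleton_subset_iff.2 hzw
    · exact subset_rfl
    · exact hsec
  have hSz : ∀ m < k, ∀ u ∈ S m, u = restr N z := by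
    intro m hm u hu
    simpa [S, hm] using hu
  have hSz' : ∀ m < L, ∀ u ∈ S m, ∀ i, (u i).2 = (restr N z i).2 := by
    intro m hm u hu i
    simp only [S] at hu
    split_ifs at hu
    · rw [Set.mem_singleton_iff.1 hu]
    · exact hu.2 i
    · rw [Set.mem_singleton_iff.1 hu]
  have hSinj : ∀ m, k' ≤ m → ∀ u ∈ S m, ∀ u' ∈ S m, (∀ i, (u i).2 = (u' i).2) → u = u' := by
    intro m hm u hu u' hu' h
    simp only [S, not_lt.2 hm, if_false] at hu hu'
    split_ifs at hu hu'
    · rw [Set.mem_singleton_iff.1 hu, Set.mem_singleton_iff.1 hu']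
    · rw [Set.mem_singleton_iff.1 hu, Set.mem_singleton_iff.1 hu']
    · exact hbij.injOn hu hu' (funext h)
  have hext : ∀ u : Fin N → Fin a × Fin b, ∃ y ∈ Ω, u ∈ words Ω N → restr N y = u := by
    intro u
    by_cases hu : u ∈ words Ω N
    · obtain ⟨y, hy, rfl⟩ := hu
      exact ⟨y, hy, fun _ => rfl⟩
    · exact ⟨z, hz, fun h => absurd h hu⟩
  choose e heΩ he using hext
  let w : (Fin L' → Fin N → Fin a × Fin b) → ℕ → ℕ → Fin a × Fin b := fun c m =>
    if h : m < L' then e (c ⟨m, h⟩) else z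
  have hw : ∀ c m, w c m ∈ Ω := by
    intro c m
    simp only [w]
    split_ifs
    · exact heΩ _
    · exact hz
  choose p hp using fun c => exists_carpet_isCode (hw c)
  obtain ⟨x, hx⟩ := exists_carpet_isCode (Ω := Ω) (w := fun _ => z) (fun _ => hz)
  let F : Finset (Fin L' → Fin N → Fin a × Fin b) :=
    Fintype.piFinset fun m : Fin L' => (Set.toFinite (S m)).toFinset
  have hFS : ∀ c ∈ F, ∀ m : Fin L', c m ∈ S m := fun c hc m =>
    (Set.Finite.mem_toFinset _).1 (Fintype.mem_piFinset.1 hc m)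
  have hwc : ∀ c ∈ F, ∀ (m : ℕ) (h : m < L') (n : ℕ) (hn : n < N),
      w c m n = c ⟨m, h⟩ ⟨n, hn⟩ := by
    intro c hc m h n hn
    simp only [w, dif_pos h]
    exact congrFun (he _ (hSw _ (hFS c hc ⟨m, h⟩))) ⟨n, hn⟩
  have hcard : F.card = blockCount Ω N k L k' L' := by
    rw [Fintype.card_piFinset, blockCount, ← prod_levels _ _ _ hkL hkL']
    refine Finset.prod_congr rfl fun m _ => ?_
    rw [← Set.ncard_eq_toFinset_card]
    simp only [S]
    split_ifs
    · simp
    · exact hzN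
    · simp
    · rfl
    · rw [wordCount, ← hbij.image_eq, hbij.injOn.ncard_image]
  have hQ : (0 : ℝ) < 36 ^ M * (a ^ k' * b ^ L') ^ K := by positivity
  refine ⟨x, ?_⟩
  rw [← log_pow_mul_pow M K (by positivity), ← hcard]
  refine log_sub_log_le_logCovering F p ?_ ?_ hQ ?_
  · rw [← Finset.card_pos, hcard]
    exact one_le_blockCount hne _ _ _ _ _
  · intro c hc
    refine bowenDist_le (le_trans (by positivity) hr) fun m hm => ?_
    refine (carpetDist_iterate_le hΩ hδ (fun n hn => ?_) hm).trans hr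
    refine max_abs_sub_le_of_isCode hx (hp c) hk hL (fun i hi => ?_) (fun i hi => ?_)
    -- Nothing forces `k` or `L` to be at most `L'`; from row `L'` on, both codings equal `z`.
    · by_cases hiL : i < L'
      · rw [hwc c hc i hiL n hn, hSz i hi _ (hFS c hc ⟨i, hiL⟩)]
        rfl
      · simp only [w, dif_neg hiL]
    · by_cases hiL : i < L'
      · rw [hwc c hc i hiL n hn, hSz' i hi _ (hFS c hc ⟨i, hiL⟩)]
        rfl
      · simp only [w, dif_neg hiL]
  · intro G hG hd
    rcases G.eq_empty_or_nonempty with rfl | ⟨c₀, hc₀⟩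
    · simpa using hQ.le
    obtain ⟨F', hF', hmem⟩ := exists_finset_indexVec hΩ M K hk' hL' (p c₀)
    have hle : G.card ≤ F'.card := by
      refine Finset.card_le_card_of_injOn (fun c => indexVec k' L' N (w c))
        (fun c hc => hmem _ _ (hp c) (hd c₀ hc₀ c hc)) ?_
      intro c hc c' hc' heq
      have hc := hG hc
      have hc' := hG hc'
      funext m
      have h2 : ∀ i : Fin N, (c m i).2 = (c' m i).2 := by
        intro i
        have := indexVec_snd_inj heq m.2 i.2
        rwa [hwc c hc m m.2 i i.2, hwc c' hc' m m.2 i i.2] at this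
      by_cases hm : (m : ℕ) < k'
      · funext i
        refine Prod.ext ?_ (h2 i)
        have := indexVec_fst_inj heq hm i.2
        rwa [hwc c hc m m.2 i i.2, hwc c' hc' m m.2 i i.2] at this
      · exact hSinj m (not_lt.1 hm) _ (hFS c hc m) _ (hFS c' hc' m) h2
    exact_mod_cast hle.trans hF'

end Counting

/-! ### From scales to levels, and the rate function -/

section Scales

theorem exp_neg_le_inv_pow_floor {a : ℕ} (ha : 2 ≤ a) {u : ℝ} (hu : 0 ≤ u) :
    Real.exp (-u) ≤ ((a : ℝ) ^ ⌊u / Real.log a⌋₊)⁻¹ := by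
  have ha' : (1 : ℝ) < a := by exact_mod_cast ha
  have hl := Real.log_pos ha'
  rw [Real.exp_neg]
  refine inv_anti₀ (by positivity) ?_
  rw [← Real.log_le_iff_le_exp (by positivity), Real.log_pow, ← le_div_iff₀ hl]
  exact Nat.floor_le (by positivity)

/-- One extra digit compensates the floor and three more give the factor `8 ≤ a ^ 3`, leaving room
for the metric tail. -/
theorem inv_pow_floor_add_le {a : ℕ} (ha : 2 ≤ a) (u : ℝ) :
    ((a : ℝ) ^ (⌊u / Real.log a⌋₊ + 4))⁻¹ ≤ Real.exp (-u) / 8 := by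
  have ha' : (1 : ℝ) < a := by exact_mod_cast ha
  have ha2 : (2 : ℝ) ≤ a := by exact_mod_cast ha
  have hl := Real.log_pos ha'
  have h1 : Real.exp u ≤ (a : ℝ) ^ (⌊u / Real.log a⌋₊ + 1) := by
    rw [← Real.le_log_iff_exp_le (by positivity), Real.log_pow, ← div_le_iff₀ hl]
    push_cast
    exact (Nat.lt_floor_add_one _).le
  have h2 : (8 : ℝ) ≤ (a : ℝ) ^ 3 := by
    calc (8 : ℝ) = 2 ^ 3 := by norm_num
      _ ≤ (a : ℝ) ^ 3 := by gcongr
  have h3 : Real.exp (-u) / 8 = (Real.exp u * 8)⁻¹ := by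
    rw [Real.exp_neg, mul_inv, div_eq_mul_inv]
  rw [h3]
  refine inv_anti₀ (by positivity) ?_
  calc Real.exp u * 8 ≤ (a : ℝ) ^ (⌊u / Real.log a⌋₊ + 1) * (a : ℝ) ^ 3 := by gcongr
    _ = (a : ℝ) ^ (⌊u / Real.log a⌋₊ + 4) := by rw [← pow_add]

theorem natCast_sub_eq_max (x y : ℕ) : ((x - y : ℕ) : ℝ) = max ((x : ℝ) - y) 0 := by
  rcases le_total y x with h | h
  · rw [Nat.cast_sub h, max_eq_left]
    have : (y : ℝ) ≤ x := by exact_mod_cast h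
    linarith
  · rw [Nat.sub_eq_zero_of_le h, max_eq_right, Nat.cast_zero]
    have : (x : ℝ) ≤ y := by exact_mod_cast h
    linarith

/-- The exponential growth rate, up to a bounded error, of the covering numbers at scale
`e ^ (-v)` of the Bowen balls of radius `e ^ (-u)` in the carpet. -/
noncomputable def growthRate (a b : ℕ) (h h' hc u v : ℝ) : ℝ :=
  (min (u / Real.log b) (v / Real.log a) - u / Real.log a) * hc +
    max (v / Real.log a - u / Real.log b) 0 * h +
    (v / Real.log b - max (u / Real.log b) (v / Real.log a)) * h'

theorem scaled_le {a b : ℕ} (hb : 2 ≤ b) (hab : b < a) {u v : ℝ} (hu : 0 ≤ u) (huv : u ≤ v) :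
    u / Real.log a ≤ u / Real.log b ∧ u / Real.log a ≤ v / Real.log a ∧
      u / Real.log b ≤ v / Real.log b ∧ v / Real.log a ≤ v / Real.log b := by
  have hb' : (1 : ℝ) < b := by exact_mod_cast hb
  have hlb := Real.log_pos hb'
  have hab' : Real.log b ≤ Real.log a := Real.log_le_log (by linarith) (by exact_mod_cast hab.le)
  have hla := hlb.trans_le hab'
  have hv := hu.trans huv
  exact ⟨by gcongr, by gcongr, by gcongr, by gcongr⟩

theorem growthRate_nonneg {a b : ℕ} (hb : 2 ≤ b) (hab : b < a) {h h' hc u v : ℝ} (h0 : 0 ≤ h)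
    (h0' : 0 ≤ h') (hc0 : 0 ≤ hc) (hu : 0 ≤ u) (huv : u ≤ v) :
    0 ≤ growthRate a b h h' hc u v := by
  obtain ⟨h1, h2, h3, h4⟩ := scaled_le hb hab hu huv
  have h5 := le_min h1 h2
  have h6 := max_le h3 h4
  rw [growthRate]
  have := mul_nonneg (sub_nonneg.2 h5) hc0
  have := mul_nonneg (sub_nonneg.2 h6) h0'
  have := mul_nonneg (le_max_right (v / Real.log a - u / Real.log b) 0) h0
  linarith

theorem growthRate_of_le {a b : ℕ} (h h' hc : ℝ) {u v : ℝ}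
    (huv : v / Real.log a ≤ u / Real.log b) :
    growthRate a b h h' hc u v = (hc / Real.log a + h' / Real.log b) * (v - u) := by
  rw [growthRate, min_eq_right huv, max_eq_right (by linarith), max_eq_left huv]
  ring

theorem growthRate_of_ge {a b : ℕ} (h h' hc : ℝ) {u v : ℝ}
    (huv : u / Real.log b ≤ v / Real.log a) :
    growthRate a b h h' hc u v = (h / Real.log a + (1 / Real.log b - 1 / Real.log a) * h') * v -
      u * ((1 / Real.log a - 1 / Real.log b) * hc + h / Real.log b) := by
  rw [growthRate, min_eq_left huv, max_eq_left (by linarith), max_eq_right huv]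
  ring

/-- Past the break, the two sides differ by `(v / log a - u / log b) * (hc + h' - h)`. -/
theorem growthRate_le {a b : ℕ} {h h' hc : ℝ} (hle : h ≤ hc + h') (u v : ℝ) :
    growthRate a b h h' hc u v ≤ (hc / Real.log a + h' / Real.log b) * (v - u) := by
  rcases le_total (v / Real.log a) (u / Real.log b) with huv | huv
  · exact (growthRate_of_le h h' hc huv).le
  · rw [growthRate_of_ge h h' hc huv, ← sub_nonneg]
    have h1 := mul_nonneg (sub_nonneg.2 huv) (sub_nonneg.2 hle)
    refine h1.trans (le_of_eq ?_)
    ring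

end Scales

/-! ### Local growth and metric mean dimension of the carpet -/

section Growth

variable {a b : ℕ} {Ω : Set (ℕ → Fin a × Fin b)} {h h' hc : ℝ}

theorem tendsto_log_blockCount_div (hne : Ω.Nonempty)
    (hh : Tendsto (fun M : ℕ => Real.log (wordCount Ω M) / M) atTop (𝓝 h))
    (hh' : Tendsto (fun M : ℕ => Real.log (wordCount (proj '' Ω) M) / M) atTop (𝓝 h'))
    (hhc : Tendsto (fun M : ℕ => Real.log (fiberCount Ω M) / M) atTop (𝓝 hc))
    (k L k' L' K : ℕ) :
    Tendsto (fun M : ℕ => Real.log (blockCount Ω (M + K) k L k' L') / M) atTop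
      (𝓝 ((min L k' - k : ℕ) * hc + (k' - L : ℕ) * h + (L' - max L k' : ℕ) * h')) := by
  have h1 := (((tendsto_shift_div hhc K).const_mul ((min L k' - k : ℕ) : ℝ)).add
    ((tendsto_shift_div hh K).const_mul ((k' - L : ℕ) : ℝ))).add
    ((tendsto_shift_div hh' K).const_mul ((L' - max L k' : ℕ) : ℝ))
  refine h1.congr fun M => ?_
  rw [log_blockCount hne]
  ring

theorem tendsto_mul_add_div (x y : ℝ) :
    Tendsto (fun M : ℕ => (M * x + y) / (M : ℝ)) atTop (𝓝 x) := by
  have h1 : Tendsto (fun M : ℕ => x + y / (M : ℝ)) atTop (𝓝 (x + 0)) :=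
    tendsto_const_nhds.add (tendsto_const_div_atTop_nhds_zero_nat _)
  rw [add_zero] at h1
  refine h1.congr' ?_
  filter_upwards [eventually_gt_atTop 0] with M hM
  have : (0 : ℝ) < M := by exact_mod_cast hM
  field_simp

theorem exists_logCovering_ball_le (hb : 2 ≤ b) (hab : b < a) (hne : Ω.Nonempty)
    (hΩ : MapsTo shift Ω Ω)
    (hh : Tendsto (fun M : ℕ => Real.log (wordCount Ω M) / M) atTop (𝓝 h))
    (hh' : Tendsto (fun M : ℕ => Real.log (wordCount (proj '' Ω) M) / M) atTop (𝓝 h'))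
    (hhc : Tendsto (fun M : ℕ => Real.log (fiberCount Ω M) / M) atTop (𝓝 hc))
    (h0 : 0 ≤ h) (h0' : 0 ≤ h') (hc0 : 0 ≤ hc) {u v : ℝ} (hu : 0 ≤ u) (huv : u ≤ v) :
    ∃ (f : ℕ → ℝ) (l : ℝ), Tendsto (fun M : ℕ => f M / M) atTop (𝓝 l) ∧
      l ≤ growthRate a b h h' hc u v + (Real.log 36 + 5 * (hc + h + h')) ∧
      ∀ M (x : carpet Ω), logCovering (carpetDist Ω) (carpetShift hΩ) M
        (bowenBall (carpetDist Ω) (carpetShift hΩ) M x (Real.exp (-u))) (Real.exp (-v)) ≤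
          (f M : EReal) := by
  have hv := hu.trans huv
  have ha : 2 ≤ a := by omega
  obtain ⟨h1, h2, h3, h4⟩ := scaled_le hb hab hu huv
  obtain ⟨K, hK⟩ := exists_pow_lt_of_lt_one (by positivity : 0 < Real.exp (-v) / 8)
    (by norm_num : (1 / 2 : ℝ) < 1)
  set k := ⌊u / Real.log a⌋₊ with hkdef
  set L := ⌊u / Real.log b⌋₊ with hLdef
  set k' := ⌊v / Real.log a⌋₊ with hkdef'
  set L' := ⌊v / Real.log b⌋₊ with hLdef'
  have hkL : k ≤ L := Nat.floor_mono h1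
  have hkL' : k' ≤ L' := Nat.floor_mono h4
  have hexp := Real.exp_pos (-v)
  have key := logCovering_ball_le (by omega) (by omega) hne hΩ (K := K) hkL
    (Nat.add_le_add_right hkL' 4) (exp_neg_le_inv_pow_floor ha hu)
    (exp_neg_le_inv_pow_floor hb hu) (inv_pow_floor_add_le ha v) (inv_pow_floor_add_le hb v)
    (by linarith : Real.exp (-v) / 8 + (1 / 2) ^ K < Real.exp (-v) / 2)
  refine ⟨_, Real.log 36 + ((min L (k' + 4) - k : ℕ) * hc + (k' + 4 - L : ℕ) * h +
    (L' + 4 - max L (k' + 4) : ℕ) * h'), ?_, ?_, key⟩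
  · simp only [add_div]
    have := (tendsto_mul_add_div (Real.log 36) (K * Real.log (a ^ k * b ^ L))).add
      (tendsto_log_blockCount_div hne hh hh' hhc k L (k' + 4) (L' + 4) K)
    simpa only [add_div] using this
  · have hL0 : 0 ≤ u / Real.log b := div_nonneg hu (Real.log_natCast_nonneg b)
    have hk0 : 0 ≤ u / Real.log a := div_nonneg hu (Real.log_natCast_nonneg a)
    have e1 := Nat.floor_le hk0
    have e2 := Nat.lt_floor_add_one (u / Real.log a)
    have e3 := Nat.floor_le hL0
    have e4 := Nat.lt_floor_add_one (u / Real.log b)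
    have e5 := Nat.floor_le (hk0.trans h2)
    have e6 := Nat.lt_floor_add_one (v / Real.log a)
    have e7 := Nat.floor_le (hL0.trans h3)
    have e8 := Nat.lt_floor_add_one (v / Real.log b)
    rw [← hkdef] at e1 e2
    rw [← hLdef] at e3 e4
    rw [← hkdef'] at e5 e6
    rw [← hLdef'] at e7 e8
    -- Each level difference is off by at most four added digits plus one for the floors. Truncated
    -- subtraction is read as a maximum with zero.
    have n1 : ((min L (k' + 4) - k : ℕ) : ℝ) ≤
        min (u / Real.log b) (v / Real.log a) - u / Real.log a + 5 := by
      rw [natCast_sub_eq_max]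
      push_cast
      refine max_le ?_ ?_ <;> simp only [min_def] <;> split_ifs <;> linarith
    have n2 : ((k' + 4 - L : ℕ) : ℝ) ≤ max (v / Real.log a - u / Real.log b) 0 + 5 := by
      rw [natCast_sub_eq_max]
      push_cast
      refine max_le ?_ ?_ <;> simp only [max_def] <;> split_ifs <;> linarith
    have n3 : ((L' + 4 - max L (k' + 4) : ℕ) : ℝ) ≤
        v / Real.log b - max (u / Real.log b) (v / Real.log a) + 5 := by
      rw [natCast_sub_eq_max]
      push_cast
      refine max_le ?_ ?_ <;> simp only [max_def] <;> split_ifs <;> linarith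
    have m1 := mul_le_mul_of_nonneg_right n1 hc0
    have m2 := mul_le_mul_of_nonneg_right n2 h0
    have m3 := mul_le_mul_of_nonneg_right n3 h0'
    rw [growthRate]
    linarith

theorem exists_le_logCovering_ball (hb : 2 ≤ b) (hab : b < a) (hne : Ω.Nonempty)
    (hΩ : MapsTo shift Ω Ω)
    (hh : Tendsto (fun M : ℕ => Real.log (wordCount Ω M) / M) atTop (𝓝 h))
    (hh' : Tendsto (fun M : ℕ => Real.log (wordCount (proj '' Ω) M) / M) atTop (𝓝 h'))
    (hhc : Tendsto (fun M : ℕ => Real.log (fiberCount Ω M) / M) atTop (𝓝 hc))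
    (h0 : 0 ≤ h) (h0' : 0 ≤ h') (hc0 : 0 ≤ hc) {u v : ℝ} (hu : 0 ≤ u) (huv : u ≤ v) :
    ∃ (f : ℕ → ℝ) (l : ℝ), Tendsto (fun M : ℕ => f M / M) atTop (𝓝 l) ∧
      growthRate a b h h' hc u v - (Real.log 36 + 5 * (hc + h + h')) ≤ l ∧
      ∀ M, ∃ x : carpet Ω, (f M : EReal) ≤ logCovering (carpetDist Ω) (carpetShift hΩ) M
        (bowenBall (carpetDist Ω) (carpetShift hΩ) M x (Real.exp (-u))) (Real.exp (-v)) := by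
  have hv := hu.trans huv
  have ha : 2 ≤ a := by omega
  obtain ⟨h1, h2, h3, h4⟩ := scaled_le hb hab hu huv
  obtain ⟨K, hK⟩ := exists_pow_lt_of_lt_one (by positivity : 0 < Real.exp (-u) / 8)
    (by norm_num : (1 / 2 : ℝ) < 1)
  set k := ⌊u / Real.log a⌋₊ with hkdef
  set L := ⌊u / Real.log b⌋₊ with hLdef
  set k' := ⌊v / Real.log a⌋₊ with hkdef'
  set L' := ⌊v / Real.log b⌋₊ with hLdef'
  have hkL : k ≤ L := Nat.floor_mono h1
  have hkL' : k' ≤ L' := Nat.floor_mono h4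
  have hexp := Real.exp_pos (-u)
  have key := le_logCovering_ball (by omega) (by omega) hne hΩ (K := K)
    (Nat.add_le_add_right hkL 4) hkL' (inv_pow_floor_add_le ha u) (inv_pow_floor_add_le hb u)
    (by linarith : Real.exp (-u) / 8 + (1 / 2) ^ K ≤ Real.exp (-u))
    (exp_neg_le_inv_pow_floor ha hv) (exp_neg_le_inv_pow_floor hb hv)
  refine ⟨_, ((min (L + 4) k' - (k + 4) : ℕ) * hc + (k' - (L + 4) : ℕ) * h +
    (L' - max (L + 4) k' : ℕ) * h') - Real.log 36, ?_, ?_, key⟩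
  · simp only [sub_div]
    exact (tendsto_log_blockCount_div hne hh hh' hhc (k + 4) (L + 4) k' L' K).sub
      (tendsto_mul_add_div (Real.log 36) (K * Real.log (a ^ k' * b ^ L')))
  · have hL0 : 0 ≤ u / Real.log b := div_nonneg hu (Real.log_natCast_nonneg b)
    have hk0 : 0 ≤ u / Real.log a := div_nonneg hu (Real.log_natCast_nonneg a)
    have e1 := Nat.floor_le hk0
    have e2 := Nat.lt_floor_add_one (u / Real.log a)
    have e3 := Nat.floor_le hL0
    have e4 := Nat.lt_floor_add_one (u / Real.log b)
    have e5 := Nat.floor_le (hk0.trans h2)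
    have e6 := Nat.lt_floor_add_one (v / Real.log a)
    have e7 := Nat.floor_le (hL0.trans h3)
    have e8 := Nat.lt_floor_add_one (v / Real.log b)
    rw [← hkdef] at e1 e2
    rw [← hLdef] at e3 e4
    rw [← hkdef'] at e5 e6
    rw [← hLdef'] at e7 e8
    have n1 : min (u / Real.log b) (v / Real.log a) - u / Real.log a - 5 ≤
        ((min (L + 4) k' - (k + 4) : ℕ) : ℝ) := by
      rw [natCast_sub_eq_max]
      push_cast
      refine le_max_of_le_left ?_
      simp only [min_def]
      split_ifs <;> linarith
    have n2 : max (v / Real.log a - u / Real.log b) 0 - 5 ≤ ((k' - (L + 4) : ℕ) : ℝ) := by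
      rw [natCast_sub_eq_max]
      push_cast
      simp only [max_def]
      split_ifs <;> linarith
    have n3 : v / Real.log b - max (u / Real.log b) (v / Real.log a) - 5 ≤
        ((L' - max (L + 4) k' : ℕ) : ℝ) := by
      rw [natCast_sub_eq_max]
      push_cast
      refine le_max_of_le_left ?_
      simp only [max_def]
      split_ifs <;> linarith
    have m1 := mul_le_mul_of_nonneg_right n1 hc0
    have m2 := mul_le_mul_of_nonneg_right n2 h0
    have m3 := mul_le_mul_of_nonneg_right n3 h0'
    rw [growthRate]
    linarith

theorem localGrowth_carpet_bounds (hb : 2 ≤ b) (hab : b < a) (hne : Ω.Nonempty)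
    (hΩ : MapsTo shift Ω Ω)
    (hh : Tendsto (fun M : ℕ => Real.log (wordCount Ω M) / M) atTop (𝓝 h))
    (hh' : Tendsto (fun M : ℕ => Real.log (wordCount (proj '' Ω) M) / M) atTop (𝓝 h'))
    (hhc : Tendsto (fun M : ℕ => Real.log (fiberCount Ω M) / M) atTop (𝓝 hc))
    (h0 : 0 ≤ h) (h0' : 0 ≤ h') (hc0 : 0 ≤ hc) {u v : ℝ} (hu : 0 ≤ u) (huv : u ≤ v) :
    ((growthRate a b h h' hc u v - (Real.log 36 + 5 * (hc + h + h')) : ℝ) : EReal) ≤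
        localGrowth (carpetDist Ω) (carpetShift hΩ) (Real.exp (-u)) (Real.exp (-v)) ∧
      localGrowth (carpetDist Ω) (carpetShift hΩ) (Real.exp (-u)) (Real.exp (-v)) ≤
        ((growthRate a b h h' hc u v + (Real.log 36 + 5 * (hc + h + h')) : ℝ) : EReal) := by
  constructor
  · obtain ⟨f, l, hf, hl, hle⟩ := exists_le_logCovering_ball hb hab hne hΩ hh hh' hhc h0 h0' hc0
      hu huv
    refine (EReal.coe_le_coe_iff.2 hl).trans
      (le_limsup_div (c := fun M : ℕ => (M : ℝ)) (fun M => M.cast_nonneg)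
        (Eventually.of_forall fun M => ?_) hf)
    obtain ⟨x, hx⟩ := hle M
    exact le_iSup_of_le x hx
  · obtain ⟨f, l, hf, hl, hle⟩ := exists_logCovering_ball_le hb hab hne hΩ hh hh' hhc h0 h0' hc0
      hu huv
    exact (limsup_div_le (c := fun M : ℕ => (M : ℝ)) (fun M => M.cast_nonneg)
        (Eventually.of_forall fun M => iSup_le (hle M)) hf).trans (EReal.coe_le_coe_iff.2 hl)

theorem scaledGrowth_carpet_bounds (hb : 2 ≤ b) (hab : b < a) (hne : Ω.Nonempty)
    (hΩ : MapsTo shift Ω Ω)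
    (hh : Tendsto (fun M : ℕ => Real.log (wordCount Ω M) / M) atTop (𝓝 h))
    (hh' : Tendsto (fun M : ℕ => Real.log (wordCount (proj '' Ω) M) / M) atTop (𝓝 h'))
    (hhc : Tendsto (fun M : ℕ => Real.log (fiberCount Ω M) / M) atTop (𝓝 hc))
    (h0 : 0 ≤ h) (h0' : 0 ≤ h') (hc0 : 0 ≤ hc) {ε : ℝ} (hε : 0 < ε) (hε1 : ε < 1) :
    (((h / Real.log a + (1 / Real.log b - 1 / Real.log a) * h') -
        (Real.log 36 + 5 * (hc + h + h')) / Real.log (1 / ε) : ℝ) : EReal) ≤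
        scaledGrowth (carpetDist Ω) (carpetShift hΩ) ε ∧
      scaledGrowth (carpetDist Ω) (carpetShift hΩ) ε ≤
        (((h / Real.log a + (1 / Real.log b - 1 / Real.log a) * h') +
          (Real.log 36 + 5 * (hc + h + h')) / Real.log (1 / ε) : ℝ) : EReal) := by
  have hv : 0 < Real.log (1 / ε) := Real.log_pos (by rw [lt_div_iff₀ hε]; linarith)
  have hexp : Real.exp (-Real.log (1 / ε)) = ε := by
    rw [one_div, Real.log_inv, neg_neg, Real.exp_log hε]
  have hG : growthRate a b h h' hc 0 (Real.log (1 / ε)) =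
      (h / Real.log a + (1 / Real.log b - 1 / Real.log a) * h') * Real.log (1 / ε) := by
    rw [growthRate_of_ge]
    · ring
    · rw [zero_div]
      exact div_nonneg hv.le (Real.log_natCast_nonneg a)
  have hdiv : ∀ {f : ℕ → ℝ} {l : ℝ}, Tendsto (fun M : ℕ => f M / M) atTop (𝓝 l) →
      Tendsto (fun M : ℕ => f M / (M * Real.log (1 / ε))) atTop (𝓝 (l / Real.log (1 / ε))) := by
    intro f l hf
    refine (hf.div_const _).congr fun M => ?_
    rw [div_div]
  constructor
  · obtain ⟨f, l, hf, hl, hle⟩ := exists_le_logCovering_ball hb hab hne hΩ hh hh' hhc h0 h0' hc0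
      le_rfl hv.le
    rw [hG] at hl
    refine le_trans (EReal.coe_le_coe_iff.2 ?_)
      (le_limsup_div (c := fun M : ℕ => M * Real.log (1 / ε)) (fun M => by positivity)
        (Eventually.of_forall fun M => ?_) (hdiv hf))
    · rw [le_div_iff₀ hv, sub_mul, div_mul_cancel₀ _ hv.ne']
      exact hl
    · obtain ⟨x, hx⟩ := hle M
      rw [hexp] at hx
      exact hx.trans (logCovering_mono (subset_univ _))
  · obtain ⟨f, l, hf, hl, hle⟩ := exists_logCovering_ball_le hb hab hne hΩ hh hh' hhc h0 h0' hc0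
      le_rfl hv.le
    rw [hG] at hl
    refine (limsup_div_le (c := fun M : ℕ => M * Real.log (1 / ε)) (fun M => by positivity)
        (Eventually.of_forall fun M => ?_) (hdiv hf)).trans (EReal.coe_le_coe_iff.2 ?_)
    -- A ball of radius `e ^ 0 = 1` about any point is the whole carpet, so the ball estimate at `u
    -- = 0` bounds the global covering number.
    · obtain ⟨w, hw⟩ := hne
      obtain ⟨x, -⟩ := exists_carpet_isCode (Ω := Ω) (w := fun _ => w) (fun _ => hw)
      have hx := hle M x
      rw [hexp, neg_zero, Real.exp_zero] at hx
      exact (logCovering_mono fun q _ => bowenDist_carpet_le_one hΩ M x q).trans hx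
    · rw [div_le_iff₀ hv, add_mul, div_mul_cancel₀ _ hv.ne']
      exact hl

theorem tendsto_scaledGrowth_carpet (hb : 2 ≤ b) (hab : b < a) (hne : Ω.Nonempty)
    (hΩ : MapsTo shift Ω Ω)
    (hh : Tendsto (fun M : ℕ => Real.log (wordCount Ω M) / M) atTop (𝓝 h))
    (hh' : Tendsto (fun M : ℕ => Real.log (wordCount (proj '' Ω) M) / M) atTop (𝓝 h'))
    (hhc : Tendsto (fun M : ℕ => Real.log (fiberCount Ω M) / M) atTop (𝓝 hc))
    (h0 : 0 ≤ h) (h0' : 0 ≤ h') (hc0 : 0 ≤ hc) :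
    Tendsto (scaledGrowth (carpetDist Ω) (carpetShift hΩ)) (𝓝[>] 0)
      (𝓝 ((h / Real.log a + (1 / Real.log b - 1 / Real.log a) * h' : ℝ) : EReal)) := by
  have hlog : Tendsto (fun ε : ℝ => Real.log (1 / ε)) (𝓝[>] 0) atTop := by
    simp only [one_div]
    exact Real.tendsto_log_atTop.comp tendsto_inv_nhdsGT_zero
  have hC := hlog.const_div_atTop (Real.log 36 + 5 * (hc + h + h'))
  have hev : ∀ᶠ ε : ℝ in 𝓝[>] 0, 0 < ε ∧ ε < 1 := Ioo_mem_nhdsGT one_pos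
  refine tendsto_of_tendsto_of_tendsto_of_le_of_le'
    (g := fun ε => (((h / Real.log a + (1 / Real.log b - 1 / Real.log a) * h') -
        (Real.log 36 + 5 * (hc + h + h')) / Real.log (1 / ε) : ℝ) : EReal))
    (h := fun ε => (((h / Real.log a + (1 / Real.log b - 1 / Real.log a) * h') +
        (Real.log 36 + 5 * (hc + h + h')) / Real.log (1 / ε) : ℝ) : EReal)) ?_ ?_ ?_ ?_
  · refine (continuous_coe_real_ereal.tendsto _).comp ?_
    simpa using tendsto_const_nhds.sub hC
  · refine (continuous_coe_real_ereal.tendsto _).comp ?_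
    simpa using tendsto_const_nhds.add hC
  · filter_upwards [hev] with ε hε
    exact (scaledGrowth_carpet_bounds hb hab hne hΩ hh hh' hhc h0 h0' hc0 hε.1 hε.2).1
  · filter_upwards [hev] with ε hε
    exact (scaledGrowth_carpet_bounds hb hab hne hΩ hh hh' hhc h0 h0' hc0 hε.1 hε.2).2

end Growth

/-! ### From growth bounds to dimensions -/

section Dimensions

theorem exp_le_ofReal_mul_iff {S : EReal} {C t s : ℝ} (hC : 0 < C) :
    EReal.exp S ≤ ENNReal.ofReal (C * Real.exp t ^ s) ↔ S ≤ ((Real.log C + s * t : ℝ) : EReal) := by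
  have : C * Real.exp t ^ s = Real.exp (Real.log C + s * t) := by
    rw [Real.exp_add, Real.exp_log hC, ← Real.exp_mul, mul_comm t s]
  rw [this, ← EReal.exp_coe, EReal.exp_le_exp_iff]

/-- With `r = e ^ (-u)`, the quantity `u / θ - u` is `log (r / r ^ (1 / θ))`. A bounded additive
error is absorbed by the multiplicative constant, and the slope `D` is the critical exponent. -/
theorem meanAssouadSpectrum_eq {X : Type*} [TopologicalSpace X] {d : X → X → ℝ} {T : X → X}
    {θ D C : ℝ} (hθ : 0 < θ) (hθ1 : θ < 1) (hD : 0 ≤ D)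
    (hS : ∀ u, 0 < u →
      ((D * (u / θ - u) - C : ℝ) : EReal) ≤
        localGrowth d T (Real.exp (-u)) (Real.exp (-(u / θ))) ∧
      localGrowth d T (Real.exp (-u)) (Real.exp (-(u / θ))) ≤
        ((D * (u / θ - u) + C : ℝ) : EReal)) :
    meanAssouadSpectrum d T θ = (D : EReal) := by
  have hpow : ∀ u : ℝ, Real.exp (-u) ^ (1 / θ) = Real.exp (-(u / θ)) := fun u => by
    rw [← Real.exp_mul]
    congr 1
    ring
  have hquot : ∀ u : ℝ, Real.exp (-u) / Real.exp (-(u / θ)) = Real.exp (u / θ - u) := fun u => by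
    rw [← Real.exp_sub]
    congr 1
    ring
  have hgap : 0 < 1 / θ - 1 := by
    rw [sub_pos, lt_div_iff₀ hθ]
    linarith
  refine le_antisymm ?_ ?_
  · refine EReal.le_of_forall_lt_iff_le.1 fun s hs => ?_
    have hs := EReal.coe_lt_coe_iff.1 hs
    refine iInf₂_le s ⟨hD.trans_lt hs, Real.exp C, Real.exp_pos _, fun r hr hr1 => ?_⟩
    have hu : 0 < -Real.log r := neg_pos.2 (Real.log_neg hr hr1)
    have hexp : Real.exp (-(-Real.log r)) = r := by rw [neg_neg, Real.exp_log hr]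
    have h1 := (hS _ hu).2
    have h2 := hpow (-Real.log r)
    have h3 := hquot (-Real.log r)
    rw [hexp] at h1 h2 h3
    rw [h2, h3, exp_le_ofReal_mul_iff (Real.exp_pos _), Real.log_exp]
    refine h1.trans (EReal.coe_le_coe_iff.2 ?_)
    have : 0 ≤ -Real.log r / θ - -Real.log r := by
      have := mul_pos hu hgap
      have e : -Real.log r * (1 / θ - 1) = -Real.log r / θ - -Real.log r := by ring
      linarith
    have := mul_le_mul_of_nonneg_right hs.le this
    linarith
  · refine le_iInf₂ fun s ⟨hs, C', hC', hsC⟩ => EReal.coe_le_coe_iff.2 ?_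
    by_contra! hlt
    -- A logarithmic scale gap so large that `D * t - C` exceeds `log C' + s * t`; the term `|C|`
    -- keeps `t` positive for negative `C`.
    set t := (C + |Real.log C'| + |C| + 1) / (D - s) with ht
    have hDs : 0 < D - s := sub_pos.2 hlt
    have ht0 : 0 < t := by
      refine div_pos ?_ hDs
      have := neg_abs_le C
      have := abs_nonneg (Real.log C')
      linarith
    have hu : 0 < t / (1 / θ - 1) := div_pos ht0 hgap
    have hut : t / (1 / θ - 1) / θ - t / (1 / θ - 1) = t := by
      have e : t / (1 / θ - 1) / θ - t / (1 / θ - 1) = t / (1 / θ - 1) * (1 / θ - 1) := by ring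
      rw [e, div_mul_cancel₀ _ hgap.ne']
    have h1 := (hS _ hu).1
    have h2 := hsC _ (Real.exp_pos _) (Real.exp_lt_one_iff.2 (neg_lt_zero.2 hu))
    rw [hpow, hquot, exp_le_ofReal_mul_iff hC', hut] at h2
    rw [hut] at h1
    have h3 := EReal.coe_le_coe_iff.1 (h1.trans h2)
    have h4 : (D - s) * t = C + |Real.log C'| + |C| + 1 := mul_div_cancel₀ _ hDs.ne'
    have := le_abs_self (Real.log C')
    have := abs_nonneg C
    linarith

theorem meanAssouadSpectrum_le_meanAssouadDim {X : Type*} [TopologicalSpace X] {d : X → X → ℝ}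
    {T : X → X} {θ : ℝ} (hθ : 0 < θ) (hθ1 : θ < 1) :
    meanAssouadSpectrum d T θ ≤ meanAssouadDim d T := by
  refine le_iInf₂ fun s ⟨hs, C, hC, h⟩ => iInf₂_le s ⟨hs, C, hC, fun r hr hr1 => ?_⟩
  refine h r _ (Real.rpow_pos_of_pos hr _) ?_
  have : (1 : ℝ) < 1 / θ := by
    rw [lt_div_iff₀ hθ]
    linarith
  simpa using Real.rpow_lt_rpow_of_exponent_gt hr hr1 this

variable {a b : ℕ} {Ω : Set (ℕ → Fin a × Fin b)}

/-- The definition of `meanAssouadDim` allows all `0 < ρ < r`, but the carpet has diameter at most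
one. Radii may thus be cut at one, which makes the logarithmic scales nonnegative. -/
theorem localGrowth_carpet_le_min (hΩ : MapsTo shift Ω Ω) (r ρ : ℝ) :
    localGrowth (carpetDist Ω) (carpetShift hΩ) r ρ ≤
      localGrowth (carpetDist Ω) (carpetShift hΩ) (min r 1) (min ρ 1) := by
  refine limsup_le_limsup (Eventually.of_forall fun M => ?_)
  refine EReal.div_le_div_right_of_nonneg (by exact_mod_cast Nat.zero_le M)
    (iSup_mono fun x => ?_)
  exact (logCovering_mono fun q hq => le_min hq (bowenDist_carpet_le_one hΩ M x q)).trans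
    (logCovering_anti (min_le_left _ _))

theorem exp_neg_max_neg_log {r : ℝ} (hr : 0 < r) : Real.exp (-max (-Real.log r) 0) = min r 1 := by
  rw [← min_neg_neg, neg_neg, neg_zero, Real.exp_monotone.map_min, Real.exp_log hr, Real.exp_zero]

theorem meanAssouadDim_carpet_le (hΩ : MapsTo shift Ω Ω) {D C : ℝ} (hD : 0 ≤ D)
    (hS : ∀ u v, 0 ≤ u → u ≤ v →
      localGrowth (carpetDist Ω) (carpetShift hΩ) (Real.exp (-u)) (Real.exp (-v)) ≤
        ((D * (v - u) + C : ℝ) : EReal)) :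
    meanAssouadDim (carpetDist Ω) (carpetShift hΩ) ≤ (D : EReal) := by
  refine EReal.le_of_forall_lt_iff_le.1 fun s hs => ?_
  have hs := EReal.coe_lt_coe_iff.1 hs
  refine iInf₂_le s ⟨hD.trans_lt hs, Real.exp C, Real.exp_pos _, fun r ρ hρ hρr => ?_⟩
  have hr := hρ.trans hρr
  have hlog := Real.log_lt_log hρ hρr
  have hquot : r / ρ = Real.exp (Real.log r - Real.log ρ) := by
    rw [Real.exp_sub, Real.exp_log hr, Real.exp_log hρ]
  rw [hquot, exp_le_ofReal_mul_iff (Real.exp_pos _), Real.log_exp]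
  have h1 := hS (max (-Real.log r) 0) (max (-Real.log ρ) 0) (le_max_right _ _)
    (max_le_max_right _ (by linarith))
  rw [exp_neg_max_neg_log hr, exp_neg_max_neg_log hρ] at h1
  refine (localGrowth_carpet_le_min hΩ r ρ).trans (h1.trans (EReal.coe_le_coe_iff.2 ?_))
  -- Cutting the scales at one does not enlarge the logarithmic gap.
  have h2 : max (-Real.log ρ) 0 - max (-Real.log r) 0 ≤ Real.log r - Real.log ρ := by
    simp only [max_def]
    split_ifs <;> linarith
  have h3 := mul_le_mul_of_nonneg_left h2 hD
  have h4 := mul_le_mul_of_nonneg_right hs.le (sub_nonneg.2 hlog.le)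
  linarith

end Dimensions

/-! ### The spectrum of the carpet and the main theorem -/

section Main

theorem growthRate_mul (a b : ℕ) (h h' hc : ℝ) {t : ℝ} (ht : 0 ≤ t) (u v : ℝ) :
    growthRate a b h h' hc (t * u) (t * v) = t * growthRate a b h h' hc u v := by
  simp only [growthRate, mul_div_assoc, ← mul_min_of_nonneg _ _ ht, ← mul_max_of_nonneg _ _ ht,
    ← mul_sub]
  rw [← mul_zero t, ← mul_max_of_nonneg _ _ ht, mul_zero]
  ring

/-- The spectrum only sees the ray `u = θ * v`, on which homogeneity makes `growthRate` an exact
multiple of `u / θ - u`. -/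
theorem meanAssouadSpectrum_carpet {a b : ℕ} (hb : 2 ≤ b) (hab : b < a)
    {Ω : Set (ℕ → Fin a × Fin b)} (hne : Ω.Nonempty) (hΩ : MapsTo shift Ω Ω) {h h' hc : ℝ}
    (hh : Tendsto (fun M : ℕ => Real.log (wordCount Ω M) / M) atTop (𝓝 h))
    (hh' : Tendsto (fun M : ℕ => Real.log (wordCount (proj '' Ω) M) / M) atTop (𝓝 h'))
    (hhc : Tendsto (fun M : ℕ => Real.log (fiberCount Ω M) / M) atTop (𝓝 hc))
    (h0 : 0 ≤ h) (h0' : 0 ≤ h') (hc0 : 0 ≤ hc) {θ : ℝ} (hθ : 0 < θ) (hθ1 : θ < 1) :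
    meanAssouadSpectrum (carpetDist Ω) (carpetShift hΩ) θ =
      ((growthRate a b h h' hc θ 1 / (1 - θ) : ℝ) : EReal) := by
  have hθ' : 0 < 1 - θ := sub_pos.2 hθ1
  refine meanAssouadSpectrum_eq (C := Real.log 36 + 5 * (hc + h + h')) hθ hθ1
    (div_nonneg (growthRate_nonneg hb hab h0 h0' hc0 hθ.le hθ1.le) hθ'.le) fun u hu => ?_
  have huv : u ≤ u / θ := by
    rw [le_div_iff₀ hθ]
    nlinarith
  have hG : growthRate a b h h' hc u (u / θ) =
      growthRate a b h h' hc θ 1 / (1 - θ) * (u / θ - u) := by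
    have e1 : growthRate a b h h' hc θ 1 / (1 - θ) * (u / θ - u) =
        u / θ * growthRate a b h h' hc θ 1 := by
      field_simp
    have e2 := growthRate_mul a b h h' hc (div_pos hu hθ).le θ 1
    rw [mul_one, div_mul_cancel₀ _ hθ.ne'] at e2
    rw [e1, e2]
  rw [← hG]
  exact localGrowth_carpet_bounds hb hab hne hΩ hh hh' hhc h0 h0' hc0 hu.le huv

end Main

end MeanAssouad

theorem mainTheorem1 (a b : ℕ) (hb : 2 ≤ b) (hab : b < a)
    (Ω : Set (ℕ → Fin a × Fin b)) (hne : Ω.Nonempty) (hcl : IsClosed Ω)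
    (hΩ : MapsTo MeanAssouad.shift Ω Ω) :
    ∃ h h' hc mM mA : ℝ,
      MeanAssouad.subshiftEntropy hΩ = (h : EReal) ∧
      MeanAssouad.subshiftEntropy (MeanAssouad.mapsTo_shift_image_proj hΩ) = (h' : EReal) ∧
      MeanAssouad.subshiftCondEntropy hΩ = (hc : EReal) ∧
      MeanAssouad.upperMetricMeanDim (MeanAssouad.carpetDist Ω) (MeanAssouad.carpetShift hΩ)
        = (mM : EReal) ∧
      MeanAssouad.lowerMetricMeanDim (MeanAssouad.carpetDist Ω) (MeanAssouad.carpetShift hΩ)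
        = (mM : EReal) ∧
      MeanAssouad.meanAssouadDim (MeanAssouad.carpetDist Ω) (MeanAssouad.carpetShift hΩ)
        = (mA : EReal) ∧
      mA = hc / Real.log a + h' / Real.log b ∧
      ∀ θ : ℝ, 0 < θ → θ < 1 →
        MeanAssouad.meanAssouadSpectrum (MeanAssouad.carpetDist Ω) (MeanAssouad.carpetShift hΩ) θ
          = ((min ((mM - θ * ((1 / Real.log a - 1 / Real.log b) * hc + h / Real.log b))
                / (1 - θ)) mA : ℝ) : EReal) ∧
        (θ ≤ Real.log b / Real.log a →
          MeanAssouad.meanAssouadSpectrum (MeanAssouad.carpetDist Ω) (MeanAssouad.carpetShift hΩ) θ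
            = (((mM - θ * ((1 / Real.log a - 1 / Real.log b) * hc + h / Real.log b))
                / (1 - θ) : ℝ) : EReal)) ∧
        (Real.log b / Real.log a ≤ θ →
          MeanAssouad.meanAssouadSpectrum (MeanAssouad.carpetDist Ω) (MeanAssouad.carpetShift hΩ) θ
            = (mA : EReal)):= by
  obtain ⟨h, h0, hh, -⟩ := MeanAssouad.exists_tendsto_log_div
    (MeanAssouad.one_le_wordCount hne) (MeanAssouad.wordCount_add_le hΩ)
  obtain ⟨h', h0', hh', -⟩ := MeanAssouad.exists_tendsto_log_div
    (MeanAssouad.one_le_wordCount (hne.image MeanAssouad.proj))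
    (MeanAssouad.wordCount_add_le (MeanAssouad.mapsTo_shift_image_proj hΩ))
  obtain ⟨hc, hc0, hhc, hhc'⟩ := MeanAssouad.exists_tendsto_log_div
    (MeanAssouad.one_le_fiberCount hne) (MeanAssouad.fiberCount_add_le hΩ)
  have hle := MeanAssouad.limit_le_add hne hh hh' hhc
  have hb1 : (1 : ℝ) < b := by exact_mod_cast hb
  have hlb := Real.log_pos hb1
  have hlab : Real.log b < Real.log a :=
    Real.log_lt_log (by linarith) (by exact_mod_cast hab)
  have hla := hlb.trans hlab
  have hlim := MeanAssouad.tendsto_scaledGrowth_carpet hb hab hne hΩ hh hh' hhc h0 h0' hc0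
  have hspec : ∀ {θ : ℝ}, 0 < θ → θ < 1 → _ := fun hθ hθ1 =>
    MeanAssouad.meanAssouadSpectrum_carpet hb hab hne hΩ hh hh' hhc h0 h0' hc0 hθ hθ1
  have hD : 0 ≤ hc / Real.log a + h' / Real.log b := by positivity
  have hlow : ∀ {θ : ℝ}, θ < 1 → θ ≤ Real.log b / Real.log a →
      MeanAssouad.growthRate a b h h' hc θ 1 / (1 - θ) =
        ((h / Real.log a + (1 / Real.log b - 1 / Real.log a) * h') -
          θ * ((1 / Real.log a - 1 / Real.log b) * hc + h / Real.log b)) / (1 - θ) := by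
    intro θ hθ1 hθ
    rw [MeanAssouad.growthRate_of_ge, mul_one]
    rw [div_le_div_iff₀ hlb hla]
    rw [le_div_iff₀ hla] at hθ
    linarith
  have hhigh : ∀ {θ : ℝ}, θ < 1 → Real.log b / Real.log a ≤ θ →
      MeanAssouad.growthRate a b h h' hc θ 1 / (1 - θ) =
        hc / Real.log a + h' / Real.log b := by
    intro θ hθ1 hθ
    rw [MeanAssouad.growthRate_of_le, mul_div_cancel_right₀ _ (sub_pos.2 hθ1).ne']
    rw [div_le_div_iff₀ hla hlb]
    rw [div_le_iff₀ hla] at hθ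
    linarith
  refine ⟨h, h', hc, h / Real.log a + (1 / Real.log b - 1 / Real.log a) * h',
    hc / Real.log a + h' / Real.log b, MeanAssouad.subshiftEntropy_eq hΩ hne hh,
    MeanAssouad.subshiftEntropy_eq _ (hne.image _) hh',
    MeanAssouad.subshiftCondEntropy_eq hΩ hne
      (MeanAssouad.tendsto_log_pointFiberCount_div hne hcl hΩ hhc hhc'),
    hlim.limsup_eq, hlim.liminf_eq, ?_, rfl, ?_⟩
  · refine le_antisymm ?_ ?_
    · refine MeanAssouad.meanAssouadDim_carpet_le hΩ (C := Real.log 36 + 5 * (hc + h + h')) hD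
        fun u v hu huv => ?_
      refine (MeanAssouad.localGrowth_carpet_bounds hb hab hne hΩ hh hh' hhc h0 h0' hc0
        hu huv).2.trans (EReal.coe_le_coe_iff.2 ?_)
      have := MeanAssouad.growthRate_le (a := a) (b := b) hle u v
      linarith
    -- The lower bound comes from the spectrum at the critical `θ`, where it already attains the
    -- Assouad value.
    · have hθ : 0 < Real.log b / Real.log a := div_pos hlb hla
      have hθ1 : Real.log b / Real.log a < 1 := (div_lt_one hla).2 hlab
      rw [← hhigh hθ1 le_rfl, ← hspec hθ hθ1]
      exact MeanAssouad.meanAssouadSpectrum_le_meanAssouadDim hθ hθ1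
  · intro θ hθ hθ1
    have hθ' : 0 < 1 - θ := sub_pos.2 hθ1
    rw [hspec hθ hθ1]
    refine ⟨?_, fun hθs => by rw [hlow hθ1 hθs], fun hθs => by rw [hhigh hθ1 hθs]⟩
    rcases le_total θ (Real.log b / Real.log a) with hθs | hθs
    · rw [hlow hθ1 hθs, min_eq_left]
      rw [← hlow hθ1 hθs, div_le_iff₀ hθ']
      exact MeanAssouad.growthRate_le hle θ 1
    · rw [hhigh hθ1 hθs, min_eq_right]
      rw [le_div_iff₀ hθ', ← sub_nonneg]
      have h1 : 1 / Real.log a ≤ θ / Real.log b := by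
        rw [div_le_div_iff₀ hla hlb]
        rw [div_le_iff₀ hla] at hθs
        linarith
      -- Above the threshold the first formula exceeds the Assouad value: after clearing `1 - θ`,
      -- the difference is this product.
      have h2 := mul_nonneg (sub_nonneg.2 h1) (sub_nonneg.2 hle)
      refine h2.trans (le_of_eq ?_)
      ring
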